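/- A \emph{metric structure} is a separable metric space $(X,d)$ together with countably many relations and functions. A relation is a subset $R\subseteq X^n\times\mathbb{R}^m$ such that $\{x\in X^n:(x,r)\in R\}$ is closed for every $r\in\mathbb{R}^m$. A function is a map $f:X^n\times\mathbb{R}^m\to X^k\times\mathbb{R}^l$ such that $x\mapsto f(x,r)$ is continuous for every $r\in\mathbb{R}^m$. The structure is \emph{complete} if $(X,d)$ is complete. $\mathrm{Aut}(X)$ is the group of bijections of $X$ that preserve $d$, all the functions and all the relations (real numbers being fixed). A \emph{substructure} is a pair consisting of a set of points of $X$ and a set of reals, together closed under $d$ and under all the functions; it is \emph{finitely generated} if it is generated by finitely many (possibly no) points of $X$. Isomorphisms of substructures are bijections between their sets of points which preserve $d$, the functions and the relations, the reals being fixed (so that both substructures have the same set of reals). A \emph{partial automorphism} of a substructure $N$ is an isomorphism between finitely generated substructures of $N$. For tuples $\bar b,\bar a$ in $X$, $\mathrm{qftp}(\bar b/\bar a)$ is the set of quantifier-free first-order formulas $\varphi(\bar x,\bar a)$ (in the language with $d$, all the functions and relations, and a constant for every real number) that are true of $\bar b$; one writes $\mathrm{qftp}(\bar b)$ if $\bar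 a$ is empty, and $\bar b\equiv_{\bar a}\bar c$ if $\mathrm{qftp}(\bar b/\bar a)=\mathrm{qftp}(\bar c/\bar a)$. For substructures, $C'\equiv_A C$ means that $\mathrm{qftp}(C'/A)=\mathrm{qftp}(C/A)$ for suitable enumerations of the points of $C'$ and $C$. For a quantifier-free type $p$ in $k$ variables, $p(X)\subseteq X^k$ is the set of its realizations. \begin{itemize} \item $X$ is \emph{homogeneous} if every isomorphism between finitely generated substructures of $X$ extends to an automorphism of $X$. \item Substructures $B,C$ are \emph{independent} over a substructure $A\subseteq B\cap C$ if for all automorphisms $\varphi$ of $B$ and $\psi$ of $C$ such that $A$ is closed under both and $\varphi\restriction A=\psi\restriction A$, the map $\varphi\cup\psi$ extends to an automorphism of the substructure generated by $B$ and $C$. $X$ has the \emph{extension property} if for all finitely generated substructures $A,B,C$ with $A\subseteq B\cap C$ there is a finitely generated substructure $C'\equiv_A C$ such that $B$ and $C'$ are independent over $A$. \item $X$ has \emph{locally finite automorphisms} if for every $n$, every finitely generated substructure $N$ and all partial automorphisms $\varphi_1,\dots,\varphi_n$ of $N$, there is a finitely generated substructure $N'\supseteq N$ such that every $\varphi_i$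 extends to an automorphism of $N'$. \item Let $\bar a\in X^k$ and $p=\mathrm{qftp}(\bar a)$. A set $Y\subseteq p(X)$ is \emph{relatively saturated over $\bar a$} if for every $\varepsilon\ge 0$, every set $q$ of quantifier-free formulas $\varphi(\bar x,\bar a)$ that is realized in $X$, contains $p(\bar x)$ and contains, for each $i\le k$, a formula $d(x_i,a_i)=\varepsilon_i$ with $0\le\varepsilon_i<\varepsilon$, is realized by an element of $Y$. \item Let $X$ be homogeneous and let $p$ be the quantifier-free type of a $k$-tuple of $X$. A sequence $(\bar a_n)_{n\in\mathbb{N}}$ in $p(X)$ is \emph{independent in $p$} if there are sets $N_n\subseteq p(X)$, with $N_n$ relatively saturated over $\bar a_n$, such that for every sequence $\bar b_n\in N_n$ with $\mathrm{qftp}(\bar b_n)=\mathrm{qftp}(\bar a_n)$ there is $g\in\mathrm{Aut}(X)$ with $g(\bar a_n)=\bar b_n$ for every $n$. $X$ \emph{admits independent sequences} if for every $k$, every $\bar a\in X^k$ and every sequence $(\bar s_n)_{n\in\mathbb{N}}$ of finite tuples of $X$ there is a sequence $(\bar a_n)$ independent in $\mathrm{qftp}(\bar a)$ with $\bar a_{n+1}\equiv_{\bar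 s_n}\bar a_n$ for every $n$. \end{itemize} \textbf{Theorem.} Let $X$ be a complete homogeneous metric structure that admits independent sequences, has locally finite automorphisms and has the extension property. Let $H$ be a Polish group whose topology is induced by a complete left-invariant metric. Then every group homomorphism $\mathrm{Aut}(X)\to H$ (not assumed continuous) is trivial. -/

import Mathlib

universe u v

/-- A countable two-sorted signature. The first sort consists of points, the second of reals.
A function symbol `f` stands for a map `X ^ domX f × ℝ ^ domR f → X ^ codX f × ℝ ^ codR f`, and a
relation symbol `R` for a subset of `X ^ relX R × ℝ ^ relR R`. The distance is not listed; it always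
belongs to the language. -/
structure MetricSignature where
  Func : Type
  Rel : Type
  countable_func : Countable Func
  countable_rel : Countable Rel
  domX : Func → ℕ
  domR : Func → ℕ
  codX : Func → ℕ
  codR : Func → ℕ
  relX : Rel → ℕ
  relR : Rel → ℕ

/-- A metric structure with underlying metric space `X` (separability and completeness of `X` are
stated separately). Continuity and closedness are demanded only in the arguments from `X`. -/
structure MetricStructure (L : MetricSignature) (X : Type u) [MetricSpace X] where
  func : (f : L.Func) → (Fin (L.domX f) → X) → (Fin (L.domR f) → ℝ) →
    (Fin (L.codX f) → X) × (Fin (L.codR f) → ℝ)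
  rel : (R : L.Rel) → Set ((Fin (L.relX R) → X) × (Fin (L.relR R) → ℝ))
  continuous_func : ∀ f r, Continuous fun x => func f x r
  isClosed_rel : ∀ R r, IsClosed {x | (x, r) ∈ rel R}

/-- The two sorts. -/
inductive MSort where
  | point
  | real

/-- Terms in variables of the first sort indexed by `V`, with a constant for every real number.
Elements of a structure occurring as parameters are represented by further variables. -/
inductive MTerm (L : MetricSignature) (V : Type u) : MSort → Type u where
  | var (x : V) : MTerm L V MSort.point
  | const (r : ℝ) : MTerm L V MSort.real
  | dist (s t : MTerm L V MSort.point) : MTerm L V MSort.real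
  | funcX (f : L.Func) (i : Fin (L.codX f)) (s : Fin (L.domX f) → MTerm L V MSort.point)
      (t : Fin (L.domR f) → MTerm L V MSort.real) : MTerm L V MSort.point
  | funcR (f : L.Func) (i : Fin (L.codR f)) (s : Fin (L.domX f) → MTerm L V MSort.point)
      (t : Fin (L.domR f) → MTerm L V MSort.real) : MTerm L V MSort.real

/-- Quantifier-free formulas in variables of the first sort indexed by `V`. -/
inductive QFFormula (L : MetricSignature) (V : Type u) : Type u where
  | eqX (s t : MTerm L V MSort.point) : QFFormula L V
  | eqR (s t : MTerm L V MSort.real) : QFFormula L V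
  | rel (R : L.Rel) (s : Fin (L.relX R) → MTerm L V MSort.point)
      (t : Fin (L.relR R) → MTerm L V MSort.real) : QFFormula L V
  | not (φ : QFFormula L V) : QFFormula L V
  | or (φ ψ : QFFormula L V) : QFFormula L V

/-- Renaming of variables in a term. -/
def MTerm.relabel {L : MetricSignature} {V : Type u} {W : Type v} (g : V → W) :
    {σ : MSort} → MTerm L V σ → MTerm L W σ
  | _, .var x => .var (g x)
  | _, .const r => .const r
  | _, .dist s t => .dist (s.relabel g) (t.relabel g)
  | _, .funcX f i s t => .funcX f i (fun j => (s j).relabel g) (fun j => (t j).relabel g)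
  | _, .funcR f i s t => .funcR f i (fun j => (s j).relabel g) (fun j => (t j).relabel g)

/-- Renaming of variables in a quantifier-free formula. -/
def QFFormula.relabel {L : MetricSignature} {V : Type u} {W : Type v} (g : V → W) :
    QFFormula L V → QFFormula L W
  | .eqX s t => .eqX (s.relabel g) (t.relabel g)
  | .eqR s t => .eqR (s.relabel g) (t.relabel g)
  | .rel R s t => .rel R (fun j => (s j).relabel g) (fun j => (t j).relabel g)
  | .not φ => .not (φ.relabel g)
  | .or φ ψ => .or (φ.relabel g) (ψ.relabel g)

/-- The carrier of each sort. -/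
abbrev MSort.Carrier (X : Type u) : MSort → Type u
  | .point => X
  | .real => ULift.{u} ℝ

namespace MetricStructure

variable {L : MetricSignature} {X : Type u} [MetricSpace X]

/-- The value of a term under an assignment of points to the variables. -/
def eval (M : MetricStructure L X) {V : Type v} (a : V → X) :
    {σ : MSort} → MTerm L V σ → σ.Carrier X
  | _, .var x => a x
  | _, .const r => ULift.up r
  | _, .dist s t =>
      ULift.up (Dist.dist (α := X) (M.eval a s) (M.eval a t))
  | _, .funcX f i s t =>
      (M.func f (fun j => M.eval a (s j)) (fun j => ULift.down (M.eval a (t j)))).1 i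
  | _, .funcR f i s t =>
      ULift.up ((M.func f (fun j => M.eval a (s j)) (fun j => ULift.down (M.eval a (t j)))).2 i)

/-- Satisfaction of a quantifier-free formula under an assignment. -/
def Sat (M : MetricStructure L X) {V : Type v} (a : V → X) : QFFormula L V → Prop
  | .eqX s t => M.eval a s = M.eval a t
  | .eqR s t => M.eval a s = M.eval a t
  | .rel R s t => ((fun j => M.eval a (s j)), (fun j => ULift.down (M.eval a (t j)))) ∈ M.rel R
  | .not φ => ¬ M.Sat a φ
  | .or φ ψ => M.Sat a φ ∨ M.Sat a ψ

/-- The quantifier-free type of a tuple. -/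
def qftp (M : MetricStructure L X) {V : Type v} (b : V → X) : Set (QFFormula L V) :=
  {φ | M.Sat b φ}

/-- The quantifier-free type of the tuple `b` over the tuple `a`: the variables on the left stand
for `b`, those on the right for the parameters `a`. -/
def qftpOver (M : MetricStructure L X) {V : Type v} {W : Type v} (b : V → X) (a : W → X) :
    Set (QFFormula L (V ⊕ W)) :=
  M.qftp (Sum.elim b a)

/-- `b` realizes the quantifier-free type `p` over `a`. -/
def Realizes (M : MetricStructure L X) {V : Type v} {W : Type v} (b : V → X) (a : W → X)
    (p : Set (QFFormula L (V ⊕ W))) : Prop :=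
  ∀ φ ∈ p, M.Sat (Sum.elim b a) φ

/-- The set `p(X)` of realizations of a quantifier-free `k`-type `p` without parameters. -/
def realizations (M : MetricStructure L X) {k : ℕ} (p : Set (QFFormula L (Fin k))) :
    Set (Fin k → X) :=
  {b | ∀ φ ∈ p, M.Sat b φ}

/-- The group of automorphisms: isometric bijections of the first sort preserving every function
and every relation (the reals are fixed). -/
def Aut (M : MetricStructure L X) : Subgroup (X ≃ᵢ X) where
  carrier := {g |
    (∀ f x r, M.func f (fun i => g (x i)) r = (fun i => g ((M.func f x r).1 i), (M.func f x r).2)) ∧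
    (∀ R x r, ((fun i => g (x i)), r) ∈ M.rel R ↔ (x, r) ∈ M.rel R)}
  one_mem' := ⟨fun _ _ _ => rfl, fun _ _ _ => Iff.rfl⟩
  mul_mem' := by
    rintro g h ⟨hg, hg'⟩ ⟨hh, hh'⟩
    refine ⟨fun f x r => ?_, fun R x r => ?_⟩
    · have := hg f (fun i => h (x i)) r
      rw [hh f x r] at this
      exact this
    · exact (hg' R (fun i => h (x i)) r).trans (hh' R x r)
  inv_mem' := by
    rintro g ⟨hg, hg'⟩
    have key : ∀ y : X, g (g⁻¹ y) = y := fun y => g.apply_symm_apply y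
    have key' : ∀ y : X, g⁻¹ (g y) = y := fun y => g.symm_apply_apply y
    refine ⟨fun f x r => ?_, fun R x r => ?_⟩
    · have := hg f (fun i => g⁻¹ (x i)) r
      simp only [key] at this
      rw [this]
      simp only [key']
    · have := hg' R (fun i => g⁻¹ (x i)) r
      simp only [key] at this
      exact this.symm

/-- A (two-sorted) substructure: sets of points and of reals closed under the distance and under
all functions. -/
structure Substructure (M : MetricStructure L X) where
  pts : Set X
  reals : Set ℝ
  dist_mem : ∀ x ∈ pts, ∀ y ∈ pts, dist x y ∈ reals
  funcX_mem : ∀ f x r, (∀ j, x j ∈ pts) → (∀ j, r j ∈ reals) → ∀ i, (M.func f x r).1 i ∈ pts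
  funcR_mem : ∀ f x r, (∀ j, x j ∈ pts) → (∀ j, r j ∈ reals) → ∀ i, (M.func f x r).2 i ∈ reals

variable {M : MetricStructure L X}

namespace Substructure

/-- `A` is contained in `B`. -/
def IsContainedIn (A B : M.Substructure) : Prop :=
  A.pts ⊆ B.pts ∧ A.reals ⊆ B.reals

/-- The substructure generated by a set of points and a set of reals. -/
def generate (M : MetricStructure L X) (S : Set X) (T : Set ℝ) : M.Substructure where
  pts := {x | ∀ N : M.Substructure, S ⊆ N.pts → T ⊆ N.reals → x ∈ N.pts}
  reals := {r | ∀ N : M.Substructure, S ⊆ N.pts → T ⊆ N.reals → r ∈ N.reals}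
  dist_mem := fun x hx y hy N hS hT => N.dist_mem x (hx N hS hT) y (hy N hS hT)
  funcX_mem := fun f x r hx hr i N hS hT =>
    N.funcX_mem f x r (fun j => hx j N hS hT) (fun j => hr j N hS hT) i
  funcR_mem := fun f x r hx hr i N hS hT =>
    N.funcR_mem f x r (fun j => hx j N hS hT) (fun j => hr j N hS hT) i

/-- Finitely generated substructures: those generated by finitely many points (possibly none). -/
def IsFG (A : M.Substructure) : Prop :=
  ∃ S : Set X, S.Finite ∧ A = generate M S ∅

/-- The substructure generated by `B` and `C`. -/
def join (B C : M.Substructure) : M.Substructure :=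
  generate M (B.pts ∪ C.pts) (B.reals ∪ C.reals)

/-- Isomorphisms of substructures: bijections of the first sort that preserve the metric, the
functions and the relations, the reals being fixed. -/
structure Iso (A B : M.Substructure) where
  toEquiv : A.pts ≃ B.pts
  reals_eq : A.reals = B.reals
  dist_eq : ∀ x y : A.pts, dist (toEquiv x : X) (toEquiv y : X) = dist (x : X) (y : X)
  funcX_eq : ∀ (f : L.Func) (x : Fin (L.domX f) → A.pts) (r : Fin (L.domR f) → ℝ)
    (hr : ∀ j, r j ∈ A.reals) (i : Fin (L.codX f)),
    (M.func f (fun j => (toEquiv (x j) : X)) r).1 i =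
      toEquiv ⟨(M.func f (fun j => (x j : X)) r).1 i,
        A.funcX_mem f _ r (fun j => (x j).2) hr i⟩
  funcR_eq : ∀ (f : L.Func) (x : Fin (L.domX f) → A.pts) (r : Fin (L.domR f) → ℝ),
    (∀ j, r j ∈ A.reals) → ∀ i : Fin (L.codR f),
    (M.func f (fun j => (toEquiv (x j) : X)) r).2 i = (M.func f (fun j => (x j : X)) r).2 i
  rel_iff : ∀ (R : L.Rel) (x : Fin (L.relX R) → A.pts) (r : Fin (L.relR R) → ℝ),
    (∀ j, r j ∈ A.reals) →
    (((fun j => (toEquiv (x j) : X)), r) ∈ M.rel R ↔ ((fun j => (x j : X)), r) ∈ M.rel R)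

/-- The isomorphism `χ` extends `φ` as a map on points. -/
def Iso.Extends {A B C D : M.Substructure} (χ : Iso C D) (φ : Iso A B) : Prop :=
  ∀ (x : X) (hA : x ∈ A.pts), ∃ hC : x ∈ C.pts, (χ.toEquiv ⟨x, hC⟩ : X) = φ.toEquiv ⟨x, hA⟩

/-- `A` is closed under the automorphism `φ` of `B`. -/
def IsClosedUnder (A : M.Substructure) {B : M.Substructure} (φ : Iso B B) : Prop :=
  ∀ x : B.pts, (x : X) ∈ A.pts → (φ.toEquiv x : X) ∈ A.pts

/-- `B` and `C` are independent over their common substructure `A`. -/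
def Independent (A B C : M.Substructure) : Prop :=
  ∀ (φ : Iso B B) (ψ : Iso C C), A.IsClosedUnder φ → A.IsClosedUnder ψ →
    (∀ (x : X) (hB : x ∈ B.pts) (hC : x ∈ C.pts), x ∈ A.pts →
      (φ.toEquiv ⟨x, hB⟩ : X) = ψ.toEquiv ⟨x, hC⟩) →
    ∃ χ : Iso (join B C) (join B C), χ.Extends φ ∧ χ.Extends ψ

/-- `C' ≡_A C`: for suitable enumerations, `C'` and `C` have the same quantifier-free type
over `A`. -/
def EquivOver (A C' C : M.Substructure) : Prop :=
  ∃ e : C.pts ≃ C'.pts,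
    M.qftpOver (fun c : C.pts => (e c : X)) (fun a : A.pts => (a : X)) =
      M.qftpOver (fun c : C.pts => (c : X)) (fun a : A.pts => (a : X))

end Substructure

/-- Every isomorphism between finitely generated substructures extends to an automorphism. -/
def IsHomogeneous (M : MetricStructure L X) : Prop :=
  ∀ A B : M.Substructure, A.IsFG → B.IsFG → ∀ φ : Substructure.Iso A B,
    ∃ g ∈ M.Aut, ∀ x : A.pts, g (x : X) = φ.toEquiv x

/-- The extension property. -/
def HasExtensionProperty (M : MetricStructure L X) : Prop :=
  ∀ A B C : M.Substructure, A.IsFG → B.IsFG → C.IsFG →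
    A.IsContainedIn B → A.IsContainedIn C →
    ∃ C' : M.Substructure, C'.IsFG ∧ A.IsContainedIn C' ∧
      Substructure.EquivOver A C' C ∧ Substructure.Independent A B C'

/-- Locally finite automorphisms. A partial automorphism of `N` is an isomorphism between finitely
generated substructures of `N`. -/
def HasLocallyFiniteAutomorphisms (M : MetricStructure L X) : Prop :=
  ∀ (n : ℕ) (N : M.Substructure), N.IsFG →
    ∀ (A B : Fin n → M.Substructure), (∀ i, (A i).IsFG) → (∀ i, (B i).IsFG) →
    (∀ i, (A i).IsContainedIn N) → (∀ i, (B i).IsContainedIn N) →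
    ∀ φ : ∀ i, Substructure.Iso (A i) (B i),
    ∃ N' : M.Substructure, N'.IsFG ∧ N.IsContainedIn N' ∧
      ∀ i, ∃ ψ : Substructure.Iso N' N', ψ.Extends (φ i)

/-- `p` is an `ε`-quantifier-free `k`-type over the `k`-tuple `a`: it contains `qftp(a)` (in the
variables `x`) and, for each `i`, a formula `d(x_i, a_i) = ε_i` with `0 ≤ ε_i < ε`. -/
def IsEpsType (M : MetricStructure L X) {k : ℕ} (ε : ℝ) (a : Fin k → X)
    (p : Set (QFFormula L (Fin k ⊕ Fin k))) : Prop :=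
  (∀ φ ∈ M.qftp a, φ.relabel Sum.inl ∈ p) ∧
  ∀ i : Fin k, ∃ δ : ℝ, 0 ≤ δ ∧ δ < ε ∧
    QFFormula.eqR (.dist (.var (Sum.inl i)) (.var (Sum.inr i))) (.const δ) ∈ p

/-- `Y ⊆ p(X)`, where `p = qftp(a)`, is relatively `ε`-saturated over `a`. -/
def IsRelSaturatedAt (M : MetricStructure L X) {k : ℕ} (ε : ℝ) (a : Fin k → X)
    (Y : Set (Fin k → X)) : Prop :=
  Y ⊆ M.realizations (M.qftp a) ∧
  ∀ p : Set (QFFormula L (Fin k ⊕ Fin k)), M.IsEpsType ε a p →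
    (∃ b : Fin k → X, M.Realizes b a p) → ∃ b ∈ Y, M.Realizes b a p

/-- `Y` is relatively saturated over `a`. -/
def IsRelSaturated (M : MetricStructure L X) {k : ℕ} (a : Fin k → X)
    (Y : Set (Fin k → X)) : Prop :=
  ∀ ε : ℝ, 0 ≤ ε → M.IsRelSaturatedAt ε a Y

/-- `s` is an independent sequence in the type `p` (for homogeneous `M`). -/
def IsIndependentSequence (M : MetricStructure L X) {k : ℕ} (p : Set (QFFormula L (Fin k)))
    (s : ℕ → Fin k → X) : Prop :=
  (∀ n, s n ∈ M.realizations p) ∧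
  ∃ N : ℕ → Set (Fin k → X), (∀ n, M.IsRelSaturated (s n) (N n)) ∧
    ∀ b : ℕ → Fin k → X, (∀ n, b n ∈ N n) → (∀ n, M.qftp (b n) = M.qftp (s n)) →
      ∃ g ∈ M.Aut, ∀ n i, g (s n i) = b n i

/-- `M` admits independent sequences. The sequence of finite tuples `t` is arbitrary. -/
def AdmitsIndependentSequences (M : MetricStructure L X) : Prop :=
  ∀ (k : ℕ) (a : Fin k → X) (m : ℕ → ℕ) (t : ∀ n, Fin (m n) → X),
    ∃ s : ℕ → Fin k → X, M.IsIndependentSequence (M.qftp a) s ∧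
      ∀ n, M.qftpOver (s (n + 1)) (t n) = M.qftpOver (s n) (t n)

end MetricStructure

/-- The topology of `H` is induced by a complete left-invariant metric. -/
def AdmitsCompleteLeftInvariantMetric (H : Type v) [Group H] [τ : TopologicalSpace H] : Prop :=
  ∃ m : MetricSpace H, m.toUniformSpace.toTopologicalSpace = τ ∧
    @CompleteSpace H m.toUniformSpace ∧ ∀ g x y : H, m.dist (g * x) (g * y) = m.dist x y

/-- `G` is `H`-trivial: every homomorphism from `G` to `H` is trivial. -/
def IsTrivialFor (G : Type u) (H : Type v) [Group G] [Group H] : Prop :=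
  ∀ (φ : G →* H) (g : G), φ g = 1

/-! Basic neighbourhoods of an automorphism consist of the automorphisms agreeing with it on a
finitely generated substructure. Since this topology need not be separable, a given `g` is first put
into a manageable subgroup. Closing off under the choices made in local finiteness and amalgamation
gives a countable group `K` containing `g` and a countable family `F` of finitely generated
substructures. The closure `Γ` of `K` along `F` is separable and complete and inherits both
properties (`exists_amalgamationSystem`). It suffices to treat homomorphisms `φ` from `Γ` to `H`.

Continuity of `φ` is automatic because `Γ` has ample generics. A generic tuple is continued to a
longer one by comeager many elements (`Generic.isComeager_update`), and generic tuples that agree on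
an invariant member of `F` are conjugate over it (`Generic.exists_conj`). Let `ℓ g` be the distance
of `φ g` from `1`. By Baire category some set `T` of elements of small length is nonmeager in every
open part of the stabilizer of some `B ∈ F`. If `g` fixes `B`, then `g T` is as large as `T`. A
binary tree whose nodes branch between `T` and `g T` yields elements `h α`, indexed by the branches,
such that for any two branches the quotient of their elements conjugates an element of `T` into `g
T`. Since `H` is separable, some such quotient has small length; hence so has an element of `g T`,
and so has `g` (`exists_forall_length_le`).

For triviality, let `g` leave `B ∈ F` invariant, and let `A n` increase in `F` so that elements
fixing `A n` have images tending to `1`. Amalgamation moves each `A n` to a position `h n • A n`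
free from `B`, so that some `u n` acts as `g` on `B` and as the identity on `h n • A n`. The `h n`
can be chosen coherently, so that `φ (h n)` is Cauchy for the left-invariant metric and converges.
As `u n` is the conjugate by `h n` of an element fixing `A n`, the images `φ (u n)` tend to `1`
(`exists_agreeOn_dist_lt`). By continuity and local finiteness, `φ g` is then arbitrarily close to
`1`. -/

section AgreeOn

/-! ### Group elements that agree on a set. -/

open scoped Pointwise

variable {Γ : Type*} {X : Type*} [Group Γ] [MulAction Γ X] {A B : Set X} {g h k l : Γ}

/-- The group elements `g` and `h` act in the same way on the set `A`. -/
def AgreeOn (A : Set X) (g h : Γ) : Prop := ∀ x ∈ A, g • x = h • x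

namespace AgreeOn

theorem refl (A : Set X) (g : Γ) : AgreeOn A g g := fun _ _ => rfl

theorem symm (H : AgreeOn A g h) : AgreeOn A h g := fun x hx => (H x hx).symm

theorem trans (H : AgreeOn A g h) (H' : AgreeOn A h k) : AgreeOn A g k :=
  fun x hx => (H x hx).trans (H' x hx)

theorem mono (H : AgreeOn B g h) (hAB : A ⊆ B) : AgreeOn A g h := fun x hx => H x (hAB hx)

theorem mul_left (H : AgreeOn A g h) (k : Γ) : AgreeOn A (k * g) (k * h) :=
  fun x hx => by rw [mul_smul, mul_smul, H x hx]

theorem mul (H' : AgreeOn (h • A) k l) (H : AgreeOn A g h) : AgreeOn A (k * g) (l * h) :=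
  fun x hx => by
    rw [mul_smul, mul_smul, H x hx]
    exact H' _ (Set.smul_mem_smul_set hx)

theorem smul_eq (H : AgreeOn A g h) : g • A = h • A := Set.image_congr H

theorem inv (H : AgreeOn A g h) : AgreeOn (g • A) g⁻¹ h⁻¹ := by
  rintro _ ⟨x, hx, rfl⟩
  change g⁻¹ • g • x = h⁻¹ • g • x
  rw [inv_smul_smul, H x hx, inv_smul_smul]

end AgreeOn

theorem agreeOn_smul_iff : AgreeOn (k • A) g h ↔ AgreeOn A (g * k) (h * k) := by
  refine ⟨fun H x hx => ?_, ?_⟩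
  · rw [mul_smul, mul_smul]
    exact H _ (Set.smul_mem_smul_set hx)
  · rintro H _ ⟨x, hx, rfl⟩
    simpa [mul_smul] using H x hx

theorem agreeOn_mul_left_iff : AgreeOn A (k * g) (k * h) ↔ AgreeOn A g h :=
  ⟨fun H => by simpa [← mul_assoc] using H.mul_left k⁻¹, fun H => H.mul_left k⟩

end AgreeOn

/-! ### Amalgamation systems and Baire category. -/

open scoped Pointwise in
/-- A countable family `F` of subsets of `X`, to be thought of as finitely generated
substructures, such that the action of `Γ` on `F` has locally finite partial automorphisms and free
amalgamation, and such that `Γ` is closed under pointwise limits along `F`. -/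
structure AmalgamationSystem (Γ : Type*) {X : Type*} [Group Γ] [MulAction Γ X]
    (F : Set (Set X)) : Prop where
  countable : F.Countable
  smul_mem : ∀ (g : Γ), ∀ A ∈ F, g • A ∈ F
  directed : ∀ A ∈ F, ∀ B ∈ F, ∃ C ∈ F, A ⊆ C ∧ B ⊆ C
  exists_bot : ∃ A ∈ F, (∀ B ∈ F, A ⊆ B) ∧ ∀ g : Γ, AgreeOn A g 1
  separable : ∃ K : Set Γ, K.Countable ∧ ∀ g : Γ, ∀ A ∈ F, ∃ k ∈ K, AgreeOn A k g
  faithful : ∀ g h : Γ, (∀ A ∈ F, AgreeOn A g h) → g = h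
  complete : ∀ (A : ℕ → Set X) (g : ℕ → Γ), (∀ n, A n ∈ F) → Monotone A →
    (∀ n, AgreeOn (A n) (g (n + 1)) (g n)) → (∀ C ∈ F, ∃ n, C ⊆ A n ∧ C ⊆ g n • A n) →
    ∃ h : Γ, ∀ n, AgreeOn (A n) h (g n)
  locallyFinite : ∀ A ∈ F, ∀ (n : ℕ) (g : ℕ → Γ), ∃ B ∈ F, A ⊆ B ∧
    ∃ h : ℕ → Γ, ∀ i < n, AgreeOn A (h i) (g i) ∧ h i • B = B
  amalgamation : ∀ A ∈ F, ∀ B ∈ F, ∀ C ∈ F, A ⊆ B → A ⊆ C →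
    ∃ k : Γ, AgreeOn A k 1 ∧ ∃ D ∈ F, B ⊆ D ∧ k • C ⊆ D ∧
      ∀ b c : Γ, b • B = B → c • C = C → b • A = A → AgreeOn A b c →
        ∃ g : Γ, g • D = D ∧ AgreeOn B g b ∧ AgreeOn (k • C) g (k * c * k⁻¹)

/-- `D` is open and dense for the topology with basic open sets `{h | AgreeOn A h g}`, `A ∈ F`. -/
structure IsOpenDense {Γ X : Type*} [Group Γ] [MulAction Γ X] (F : Set (Set X)) (D : Set Γ) :
    Prop where
  isOpen : ∀ g ∈ D, ∃ A ∈ F, ∀ h, AgreeOn A h g → h ∈ D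
  dense : ∀ g, ∀ A ∈ F, ∃ h ∈ D, AgreeOn A h g

/-- `R` contains a countable intersection of open dense sets. -/
def IsComeager {Γ X : Type*} [Group Γ] [MulAction Γ X] (F : Set (Set X)) (R : Set Γ) : Prop :=
  ∃ 𝒟 : Set (Set Γ), 𝒟.Countable ∧ (∀ D ∈ 𝒟, IsOpenDense F D) ∧ ⋂₀ 𝒟 ⊆ R

section Comeager

variable {Γ X : Type*} [Group Γ] [MulAction Γ X] {F : Set (Set X)}

theorem IsOpenDense.isComeager {D : Set Γ} (hD : IsOpenDense F D) : IsComeager F D :=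
  ⟨{D}, Set.countable_singleton D, by simpa using hD, by simp⟩

theorem IsComeager.univ : IsComeager F (Set.univ : Set Γ) :=
  ⟨∅, Set.countable_empty, by simp, by simp⟩

theorem IsComeager.mono {R S : Set Γ} (hR : IsComeager F R) (hRS : R ⊆ S) : IsComeager F S := by
  obtain ⟨𝒟, h1, h2, h3⟩ := hR
  exact ⟨𝒟, h1, h2, h3.trans hRS⟩

theorem IsComeager.iInter {ι : Type*} [Countable ι] {R : ι → Set Γ}
    (hR : ∀ i, IsComeager F (R i)) : IsComeager F (⋂ i, R i) := by
  choose 𝒟 h1 h2 h3 using hR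
  refine ⟨⋃ i, 𝒟 i, Set.countable_iUnion h1, ?_, ?_⟩
  · intro D hD
    obtain ⟨i, hi⟩ := Set.mem_iUnion.1 hD
    exact h2 i D hi
  · intro g hg
    refine Set.mem_iInter.2 fun i => h3 i fun D hD => hg D (Set.mem_iUnion.2 ⟨i, hD⟩)

theorem IsComeager.inter {R S : Set Γ} (hR : IsComeager F R) (hS : IsComeager F S) :
    IsComeager F (R ∩ S) := by
  rw [Set.inter_eq_iInter]
  exact IsComeager.iInter (by rintro (_ | _) <;> assumption)

theorem IsOpenDense.preimage_mul_left {D : Set Γ} (hD : IsOpenDense F D) (k : Γ) :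
    IsOpenDense F {g | k * g ∈ D} := by
  refine ⟨fun g hg => ?_, fun g A hA => ?_⟩
  · obtain ⟨A, hA, H⟩ := hD.isOpen _ hg
    exact ⟨A, hA, fun h hh => H _ (hh.mul_left k)⟩
  · obtain ⟨h, hh, H⟩ := hD.dense (k * g) A hA
    refine ⟨k⁻¹ * h, by simpa using hh, ?_⟩
    simpa [← mul_assoc] using H.mul_left k⁻¹

theorem IsComeager.preimage_mul_left {R : Set Γ} (hR : IsComeager F R) (k : Γ) :
    IsComeager F {g | k * g ∈ R} := by
  obtain ⟨𝒟, h1, h2, h3⟩ := hR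
  refine ⟨(fun D => {g | k * g ∈ D}) '' 𝒟, h1.image _, ?_, ?_⟩
  · rintro _ ⟨D, hD, rfl⟩
    exact (h2 D hD).preimage_mul_left k
  · intro g hg
    refine h3 fun D hD => hg _ ⟨D, hD, rfl⟩

end Comeager

namespace AmalgamationSystem

open scoped Pointwise

variable {Γ X : Type*} [Group Γ] [MulAction Γ X] {F : Set (Set X)}

theorem directed₃ (S : AmalgamationSystem Γ F) {A B C : Set X} (hA : A ∈ F) (hB : B ∈ F)
    (hC : C ∈ F) : ∃ D ∈ F, A ⊆ D ∧ B ⊆ D ∧ C ⊆ D := by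
  obtain ⟨D, hD, h1, h2⟩ := S.directed A hA B hB
  obtain ⟨E, hE, h3, h4⟩ := S.directed D hD C hC
  exact ⟨E, hE, h1.trans h3, h2.trans h3, h4⟩

theorem exists_enumeration (S : AmalgamationSystem Γ F) :
    ∃ C : ℕ → Set X, (∀ n, C n ∈ F) ∧ ∀ A ∈ F, ∃ n, C n = A := by
  obtain ⟨A₀, hA₀, -⟩ := S.exists_bot
  obtain ⟨C, hC⟩ := S.countable.exists_eq_range ⟨A₀, hA₀⟩
  exact ⟨C, fun n => hC ▸ ⟨n, rfl⟩, fun A hA => by rwa [hC] at hA⟩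

/-- Construction of a group element as a limit of successive approximations. -/
theorem exists_limit (S : AmalgamationSystem Γ F) (P : ℕ → Γ → Set X → Prop) {g₀ : Γ}
    {A₀ : Set X} (hA₀ : A₀ ∈ F) (h₀ : P 0 g₀ A₀)
    (step : ∀ n g A, A ∈ F → P n g A → ∀ C ∈ F, ∃ g' A', A' ∈ F ∧ A ⊆ A' ∧ C ⊆ A' ∧
      C ⊆ g' • A' ∧ AgreeOn A g' g ∧ P (n + 1) g' A') :
    ∃ (h : Γ) (g : ℕ → Γ) (A : ℕ → Set X), g 0 = g₀ ∧ A 0 = A₀ ∧ Monotone A ∧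
      (∀ n, A n ∈ F ∧ P n (g n) (A n) ∧ AgreeOn (A n) h (g n)) ∧ ∀ C ∈ F, ∃ n, C ⊆ A n := by
  obtain ⟨C, hCF, hC⟩ := S.exists_enumeration
  choose! gn An h1 h2 h3 h4 h5 h6 using step
  let s : ℕ → Γ × Set X := fun n => Nat.rec (g₀, A₀)
    (fun n p => (gn n p.1 p.2 (C n), An n p.1 p.2 (C n))) n
  have hs : ∀ n, (s n).2 ∈ F ∧ P n (s n).1 (s n).2 := by
    intro n
    induction n with
    | zero => exact ⟨hA₀, h₀⟩
    | succ n ih =>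
      exact ⟨h1 n _ _ ih.1 ih.2 _ (hCF n), h6 n _ _ ih.1 ih.2 _ (hCF n)⟩
  have hmono : Monotone fun n => (s n).2 :=
    monotone_nat_of_le_succ fun n => h2 n _ _ (hs n).1 (hs n).2 _ (hCF n)
  have hcof : ∀ D ∈ F, ∃ n, D ⊆ (s n).2 ∧ D ⊆ (s n).1 • (s n).2 := by
    intro D hD
    obtain ⟨n, rfl⟩ := hC D hD
    exact ⟨n + 1, h3 n _ _ (hs n).1 (hs n).2 _ hD, h4 n _ _ (hs n).1 (hs n).2 _ hD⟩
  obtain ⟨h, hh⟩ := S.complete (fun n => (s n).2) (fun n => (s n).1) (fun n => (hs n).1) hmono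
    (fun n => h5 n _ _ (hs n).1 (hs n).2 _ (hCF n)) hcof
  exact ⟨h, fun n => (s n).1, fun n => (s n).2, rfl, rfl, hmono,
    fun n => ⟨(hs n).1, (hs n).2, hh n⟩, fun D hD => (hcof D hD).imp fun _ h => h.1⟩

/-- The Baire category theorem. -/
theorem exists_mem_of_isComeager (S : AmalgamationSystem Γ F) {R : Set Γ} (hR : IsComeager F R)
    (g : Γ) {A : Set X} (hA : A ∈ F) : ∃ h ∈ R, AgreeOn A h g := by
  obtain ⟨𝒟, h1, h2, h3⟩ := hR
  have hne : (insert Set.univ 𝒟).Nonempty := ⟨_, Set.mem_insert _ _⟩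
  obtain ⟨D, hD⟩ := (h1.insert Set.univ).exists_eq_range hne
  have hDd : ∀ n, IsOpenDense F (D n) := by
    intro n
    have : D n ∈ insert Set.univ 𝒟 := hD ▸ ⟨n, rfl⟩
    rcases this with h | h
    · rw [h]
      exact ⟨fun _ _ => ⟨A, hA, fun _ _ => trivial⟩, fun g _ _ => ⟨g, trivial, AgreeOn.refl _ _⟩⟩
    · exact h2 _ h
  -- Stage `m + 1` secures membership in `D m`; stage `0` carries no condition, so the construction
  -- can start from `g` and `A`.
  obtain ⟨h, gs, As, e1, e2, -, H, -⟩ := S.exists_limit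
    (fun n g A => ∀ m, n = m + 1 → ∀ h, AgreeOn A h g → h ∈ D m) (g₀ := g) hA (by simp) (by
      intro n g A hA _ C hC
      obtain ⟨g', hg', hgg'⟩ := (hDd n).dense g A hA
      obtain ⟨A', hA', H⟩ := (hDd n).isOpen g' hg'
      obtain ⟨B, hB, b1, b2, b3⟩ := S.directed₃ hA hA' hC
      obtain ⟨B', hB', b4, b5⟩ := S.directed B hB _ (S.smul_mem g'⁻¹ C hC)
      refine ⟨g', B', hB', b1.trans b4, b3.trans b4, ?_, hgg', ?_⟩
      · rwa [Set.subset_smul_set_iff]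
      · intro m hm h hh
        obtain rfl : n = m := by omega
        exact H h (hh.mono (b2.trans b4)))
  refine ⟨h, h3 fun E hE => ?_, ?_⟩
  · have : E ∈ Set.range D := hD ▸ Set.mem_insert_of_mem _ hE
    obtain ⟨n, rfl⟩ := this
    exact (H (n + 1)).2.1 n rfl h (H (n + 1)).2.2
  · simpa [e1, e2] using (H 0).2.2

/-! ### Generic tuples and their conjugacy. -/

/-- The first `n` elements of `x` form a generic tuple: `F` has cofinally many invariant members,
and over an invariant member all finite extensions are realized. -/
structure Generic (F : Set (Set X)) (n : ℕ) (x : ℕ → Γ) : Prop where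
  cofinal : ∀ A ∈ F, ∃ B ∈ F, A ⊆ B ∧ ∀ i < n, x i • B = B
  realizes : ∀ B ∈ F, ∀ C ∈ F, B ⊆ C → (∀ i < n, x i • B = B) → ∀ z : ℕ → Γ,
    (∀ i < n, z i • C = C ∧ AgreeOn B (z i) (x i)) →
    ∃ e : Γ, AgreeOn B e 1 ∧ ∀ i < n, AgreeOn C (x i * e) (e * z i)

theorem generic_zero (F : Set (Set X)) (x : ℕ → Γ) : Generic F 0 x :=
  ⟨fun A hA => ⟨A, hA, subset_rfl, by simp⟩, fun _ _ _ _ _ _ _ _ =>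
    ⟨1, AgreeOn.refl _ _, by simp⟩⟩

/-- The map `f` carries the action of `x` on a larger invariant set `B'` to an extension of the
action of `y` on `f • B`. Genericity of `y` realizes this extension by some `e` fixing `f • B`, and
`e * f` is the required correction of `f`. -/
theorem Generic.forth (S : AmalgamationSystem Γ F) {n : ℕ} {x y : ℕ → Γ} (hx : Generic F n x)
    (hy : Generic F n y) {B : Set X} (hB : B ∈ F) (hxB : ∀ i < n, x i • B = B) {f : Γ}
    (hf : ∀ i < n, AgreeOn B (f * x i) (y i * f)) {C : Set X} (hC : C ∈ F) :
    ∃ B' ∈ F, B ⊆ B' ∧ C ⊆ B' ∧ (∀ i < n, x i • B' = B') ∧ ∃ f' : Γ, AgreeOn B f' f ∧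
      ∀ i < n, AgreeOn B' (f' * x i) (y i * f') := by
  obtain ⟨D, hD, d1, d2⟩ := S.directed B hB C hC
  obtain ⟨B', hB', b1, b2⟩ := hx.cofinal D hD
  obtain ⟨e, e1, e2⟩ := hy.realizes (f • B) (S.smul_mem f B hB) (f • B') (S.smul_mem f B' hB')
    (Set.smul_set_mono (d1.trans b1)) (fun i hi => by
      rw [← mul_smul, ← (hf i hi).smul_eq, mul_smul, hxB i hi])
    (fun i => f * x i * f⁻¹) (fun i hi => ⟨by
      rw [mul_smul, inv_smul_smul, mul_smul, b2 i hi], by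
      rw [agreeOn_smul_iff]; simpa using hf i hi⟩)
  refine ⟨B', hB', d1.trans b1, d2.trans b1, b2, e * f, ?_, fun i hi => ?_⟩
  · rw [agreeOn_smul_iff] at e1
    simpa using e1
  · have := (agreeOn_smul_iff.1 (e2 i hi)).symm
    simpa [mul_assoc] using this

/-- Generic tuples that agree on an invariant set are conjugate over that set. -/
theorem Generic.exists_conj (S : AmalgamationSystem Γ F) {n : ℕ} {x y : ℕ → Γ}
    (hx : Generic F n x) (hy : Generic F n y) {B : Set X} (hB : B ∈ F)
    (hxB : ∀ i < n, x i • B = B) (hxy : ∀ i < n, AgreeOn B (x i) (y i)) :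
    ∃ f : Γ, AgreeOn B f 1 ∧ ∀ i < n, f * x i = y i * f := by
  obtain ⟨f, fs, Bs, e1, e2, -, H, hcof⟩ := S.exists_limit
    (fun _ f B => ∀ i < n, x i • B = B ∧ AgreeOn B (f * x i) (y i * f)) (g₀ := 1) hB
    (fun i hi => ⟨hxB i hi, by simpa using hxy i hi⟩) (by
      intro _ f B hB hfB C hC
      obtain ⟨B', hB', b1, b2, b3, f', f1, f2⟩ := Generic.forth S hx hy hB
        (fun i hi => (hfB i hi).1) (fun i hi => (hfB i hi).2) hC
      -- The step back: exchanging the two tuples and extending `f'⁻¹` brings `C` into the range of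
      -- the new map `k⁻¹`.
      obtain ⟨D, hD, d1, d2, d3, k, k1, k2⟩ := Generic.forth S hy hx (S.smul_mem f' B' hB')
        (fun i hi => by rw [← mul_smul, ← (f2 i hi).smul_eq, mul_smul, b3 i hi])
        (f := f'⁻¹) (fun i hi => by
          rw [agreeOn_smul_iff]
          have := ((f2 i hi).mul_left f'⁻¹).symm
          simpa [mul_assoc] using this) hC
      have k1' : AgreeOn B' k⁻¹ f' := by
        have := k1.inv
        rw [k1.smul_eq, inv_smul_smul] at this
        simpa using this
      have hB'D : B' ⊆ k • D := by
        calc B' = k • f' • B' := by rw [k1.smul_eq, inv_smul_smul]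
          _ ⊆ k • D := Set.smul_set_mono d1
      refine ⟨k⁻¹, k • D, S.smul_mem k D hD, b1.trans hB'D, b2.trans hB'D, by simpa using d2,
        (k1'.mono b1).trans f1, fun i hi => ⟨?_, ?_⟩⟩
      · rw [← mul_smul, ← (k2 i hi).smul_eq, mul_smul, d3 i hi]
      · rw [agreeOn_smul_iff]
        have := ((k2 i hi).mul_left k⁻¹).symm
        simpa [mul_assoc] using this)
  refine ⟨f, by simpa [e1, e2] using (H 0).2.2, fun i hi => S.faithful _ _ fun A hA => ?_⟩
  obtain ⟨m, hm⟩ := hcof A hA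
  obtain ⟨h1, h2, h3⟩ := H m
  refine AgreeOn.mono (fun b hb => ?_) hm
  have hb' : x i • b ∈ Bs m := by
    rw [← (h2 i hi).1]; exact Set.smul_mem_smul_set hb
  rw [mul_smul, mul_smul, h3 _ hb', h3 _ hb, ← mul_smul, ← mul_smul]
  exact (h2 i hi).2 b hb

end AmalgamationSystem

/-! ### Continuing generic tuples. -/

namespace AmalgamationSystem

open scoped Pointwise

variable {Γ X : Type*} [Group Γ] [MulAction Γ X] {F : Set (Set X)}

/-- Local finiteness relative to a generic tuple: an element `g` can be modified off a given set so
as to leave invariant, together with the tuple, a larger member of `F`. -/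
theorem Generic.exists_extension (S : AmalgamationSystem Γ F) {n : ℕ} {x : ℕ → Γ}
    (hx : Generic F n x) (g : Γ) {A : Set X} (hA : A ∈ F) :
    ∃ A' ∈ F, A ⊆ A' ∧ g • A ⊆ A' ∧ (∀ i < n, x i • A' = A') ∧ ∃ N ∈ F, A' ⊆ N ∧
      ∃ (z : ℕ → Γ) (w : Γ), (∀ i < n, AgreeOn A' (z i) (x i) ∧ z i • N = N) ∧
        AgreeOn A' w g ∧ w • N = N := by
  obtain ⟨D, hD, d1, d2⟩ := S.directed A hA _ (S.smul_mem g A hA)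
  obtain ⟨A', hA', h1, h2⟩ := hx.cofinal D hD
  -- Slot `n`, which does not belong to the tuple, carries `g`.
  obtain ⟨N, hN, n1, z, hz⟩ := S.locallyFinite A' hA' (n + 1) (Function.update x n g)
  refine ⟨A', hA', d1.trans h1, d2.trans h1, h2, N, hN, n1, z, z n, fun i hi => ?_, ?_⟩
  · have := hz i (by omega)
    rwa [Function.update_of_ne (by omega)] at this
  · have := hz n (by omega)
    rwa [Function.update_self] at this

theorem agreeOn_conj_of_fixes {A A' : Set X} {e u g : Γ} (he : AgreeOn A' e 1) (hA : A ⊆ A')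
    (hgA : g • A ⊆ A') (hu : AgreeOn A u g) : AgreeOn A (e * u * e⁻¹) g := by
  intro a ha
  have h1 : e⁻¹ • a = a := by
    rw [inv_smul_eq_iff, he a (hA ha), one_smul]
  rw [mul_smul, mul_smul, h1, hu a ha, he _ (hgA (Set.smul_mem_smul_set ha)), one_smul]

/-- For density, local finiteness gives a set `N` invariant under a copy `z` of the tuple and a copy
`w` of `g`. Genericity realizes `z` by some `e` fixing the part where `g` is prescribed together
with its image. The conjugate of `w` by `e` then still agrees with `g` there and leaves `e • N`
invariant along with `x`. -/
theorem isOpenDense_cofinal (S : AmalgamationSystem Γ F) {n : ℕ} {x : ℕ → Γ}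
    (hx : Generic F n x) {A : Set X} (hA : A ∈ F) :
    IsOpenDense F {y : Γ | ∃ B ∈ F, A ⊆ B ∧ (∀ i < n, x i • B = B) ∧ y • B = B} := by
  constructor
  · rintro g ⟨B, hB, h1, h2, h3⟩
    exact ⟨B, hB, fun h hh => ⟨B, hB, h1, h2, hh.smul_eq.trans h3⟩⟩
  · intro g A₁ hA₁
    obtain ⟨E, hE, e1, e2⟩ := S.directed A hA A₁ hA₁
    obtain ⟨A', hA', a1, a2, a3, N, hN, n1, z, w, hz, hw, hwN⟩ := hx.exists_extension S g hE
    obtain ⟨e, he, hez⟩ := hx.realizes A' hA' N hN n1 a3 z (fun i hi => (hz i hi).symm)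
    refine ⟨e * w * e⁻¹, ⟨e • N, S.smul_mem e N hN, ?_, ?_, ?_⟩, ?_⟩
    · intro a ha
      have : e • a = a := by simpa using he a (a1 (e1 ha))
      rw [← this]
      exact Set.smul_mem_smul_set (n1 (a1 (e1 ha)))
    · intro i hi
      rw [← mul_smul, (hez i hi).smul_eq, mul_smul, (hz i hi).2]
    · rw [mul_smul, inv_smul_smul, mul_smul, hwN]
    · exact (agreeOn_conj_of_fixes he a1 a2 (hw.mono a1)).mono e2

/-- This is where amalgamation enters. A set `N` on which a modification of `g` and a copy of the
tuple act is amalgamated over `B` with the prescribed extension on `C`. Genericity of `x` realizes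
the amalgam by some `e`; the copy `k • C` inside it is the sought realization, so `e * k` is the
witness. -/
theorem isOpenDense_realizes (S : AmalgamationSystem Γ F) {n : ℕ} {x : ℕ → Γ}
    (hx : Generic F n x) {B C : Set X} (hB : B ∈ F) (hC : C ∈ F) (hBC : B ⊆ C)
    (hxB : ∀ i < n, x i • B = B) (z : ℕ → Γ) (v : Γ)
    (hz : ∀ i < n, z i • C = C ∧ AgreeOn B (z i) (x i)) (hv : v • C = C) :
    IsOpenDense F {y : Γ | y • B = B → AgreeOn B v y → ∃ e : Γ, AgreeOn B e 1 ∧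
      (∀ i < n, AgreeOn C (x i * e) (e * z i)) ∧ AgreeOn C (y * e) (e * v)} := by
  constructor
  · intro g hg
    by_cases hgB : g • B = B ∧ AgreeOn B v g
    · obtain ⟨e, e1, e2, e3⟩ := hg hgB.1 hgB.2
      exact ⟨e • C, S.smul_mem e C hC, fun h hh _ _ =>
        ⟨e, e1, e2, (agreeOn_smul_iff.1 hh).trans e3⟩⟩
    · exact ⟨B, hB, fun h hh h1 h2 =>
        absurd ⟨hh.smul_eq.symm.trans h1, h2.trans hh⟩ hgB⟩
  · intro g A₁ hA₁
    by_cases hgB : g • B = B ∧ AgreeOn B v g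
    · obtain ⟨E, hE, e1, e2⟩ := S.directed B hB A₁ hA₁
      obtain ⟨A', hA', a1, a2, a3, N, hN, n1, z', w, hz', hw, hwN⟩ := hx.exists_extension S g hE
      have hBA' := e1.trans a1
      obtain ⟨k, hk, D, hD, hND, hkC, ham⟩ :=
        S.amalgamation B hB N hN C hC (hBA'.trans n1) hBC
      have hu : ∀ i, ∃ u : Γ, i < n → u • D = D ∧ AgreeOn N u (z' i) ∧
          AgreeOn (k • C) u (k * z i * k⁻¹) := by
        intro i
        by_cases hi : i < n
        · obtain ⟨u, hu⟩ := ham (z' i) (z i) (hz' i hi).2 (hz i hi).1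
            (((hz' i hi).1.mono hBA').smul_eq.trans (hxB i hi))
            (((hz' i hi).1.mono hBA').trans (hz i hi).2.symm)
          exact ⟨u, fun _ => hu⟩
        · exact ⟨1, fun h => absurd h hi⟩
      choose u hu using hu
      obtain ⟨t, htD, htN, htC⟩ := ham w v hwN hv ((hw.mono hBA').smul_eq.trans hgB.1)
        ((hw.mono hBA').trans hgB.2.symm)
      obtain ⟨e, he, hez⟩ := hx.realizes A' hA' D hD (n1.trans hND) a3 u
        (fun i hi => ⟨(hu i hi).1, ((hu i hi).2.1.mono n1).trans (hz' i hi).1⟩)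
      refine ⟨e * t * e⁻¹, fun _ _ => ⟨e * k, ?_, fun i hi => ?_, ?_⟩, ?_⟩
      · intro b hb
        rw [mul_smul, hk b hb, one_smul, he b (hBA' hb), one_smul]
      · have h1 := agreeOn_smul_iff.1 ((hez i hi).mono hkC)
        have h2 := (agreeOn_smul_iff.1 (hu i hi).2.2).mul_left e
        simpa [mul_assoc] using h1.trans (by simpa [mul_assoc] using h2)
      · have h2 := (agreeOn_smul_iff.1 htC).mul_left e
        simpa [mul_assoc] using h2
      · exact (agreeOn_conj_of_fixes he a1 a2 ((htN.mono n1).trans hw |>.mono a1)).mono e2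
    · exact ⟨g, fun h1 h2 => absurd ⟨h1, h2⟩ hgB, AgreeOn.refl _ _⟩

/-- A generic tuple can be continued by comeager many elements. -/
theorem Generic.isComeager_update (S : AmalgamationSystem Γ F) {n : ℕ} {x : ℕ → Γ}
    (hx : Generic F n x) : IsComeager F {y : Γ | Generic F (n + 1) (Function.update x n y)} := by
  obtain ⟨K, hK, hKF⟩ := S.separable
  have := S.countable.to_subtype
  have := hK.to_subtype
  -- Only the restrictions of `z` and `v` to `C` matter, so entries from the countable set `K`
  -- suffice and countably many dense open sets remain.
  let z' : (Fin n → K) → ℕ → Γ := fun z i => if h : i < n then z ⟨i, h⟩ else 1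
  have hR : ∀ t : F × F × (Fin n → K) × K, IsComeager F {y : Γ | (t.1 : Set X) ⊆ t.2.1 →
      (∀ i < n, x i • (t.1 : Set X) = t.1) →
      (∀ i < n, z' t.2.2.1 i • (t.2.1 : Set X) = t.2.1 ∧ AgreeOn (t.1 : Set X) (z' t.2.2.1 i) (x i)) →
      (t.2.2.2 : Γ) • (t.2.1 : Set X) = t.2.1 →
      y • (t.1 : Set X) = t.1 → AgreeOn (t.1 : Set X) (t.2.2.2 : Γ) y → ∃ e : Γ,
        AgreeOn (t.1 : Set X) e 1 ∧
        (∀ i < n, AgreeOn (t.2.1 : Set X) (x i * e) (e * z' t.2.2.1 i)) ∧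
        AgreeOn (t.2.1 : Set X) (y * e) (e * t.2.2.2)} := by
    rintro ⟨⟨B, hB⟩, ⟨C, hC⟩, z, v⟩
    by_cases H : B ⊆ C ∧ (∀ i < n, x i • B = B) ∧
        (∀ i < n, z' z i • C = C ∧ AgreeOn B (z' z i) (x i)) ∧ (v : Γ) • C = C
    · exact (isOpenDense_realizes S hx hB hC H.1 H.2.1 (z' z) v H.2.2.1 H.2.2.2).isComeager.mono
        fun y hy _ _ _ _ => hy
    · exact IsComeager.univ.mono fun y _ h1 h2 h3 h4 => absurd ⟨h1, h2, h3, h4⟩ H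
  have hQ : ∀ A : F, IsComeager F {y : Γ | ∃ B ∈ F, (A : Set X) ⊆ B ∧ (∀ i < n, x i • B = B) ∧
      y • B = B} := fun A => (isOpenDense_cofinal S hx A.2).isComeager
  refine ((IsComeager.iInter hQ).inter (IsComeager.iInter hR)).mono ?_
  rintro y ⟨hy1, hy2⟩
  rw [Set.mem_iInter] at hy1 hy2
  have hupd : ∀ i < n, Function.update x n y i = x i := fun i hi =>
    Function.update_of_ne (by omega) _ _
  constructor
  · intro A hA
    obtain ⟨B, hB, h1, h2, h3⟩ := hy1 ⟨A, hA⟩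
    refine ⟨B, hB, h1, fun i hi => ?_⟩
    rcases Nat.lt_succ_iff_lt_or_eq.1 hi with hi | rfl
    · rw [hupd i hi, h2 i hi]
    · rw [Function.update_self, h3]
  · intro B hB C hC hBC hxB z hz
    choose k hkK hk using fun g => hKF g C hC
    have hz'k : ∀ i < n, z' (fun j => ⟨k (z j), hkK _⟩) i = k (z i) := fun i hi => by
      simp [z', hi]
    have hxn := hxB n (by omega)
    have hzn := hz n (by omega)
    rw [Function.update_self] at hxn hzn
    have hlt : ∀ i < n, x i • B = B ∧ z i • C = C ∧ AgreeOn B (z i) (x i) := by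
      intro i hi
      have h1 := hxB i (by omega)
      have h2 := hz i (by omega)
      rw [hupd i hi] at h1 h2
      exact ⟨h1, h2⟩
    obtain ⟨e, e1, e2, e3⟩ := hy2 (⟨B, hB⟩, ⟨C, hC⟩, fun j => ⟨k (z j), hkK _⟩, ⟨k (z n), hkK _⟩)
      hBC (fun i hi => (hlt i hi).1)
      (fun i hi => by
        dsimp only
        rw [hz'k i hi]
        exact ⟨(hk _).smul_eq.trans (hlt i hi).2.1, ((hk _).mono hBC).trans (hlt i hi).2.2⟩)
      ((hk _).smul_eq.trans hzn.1) hxn (((hk _).mono hBC).trans hzn.2)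
    refine ⟨e, e1, fun i hi => ?_⟩
    rcases Nat.lt_succ_iff_lt_or_eq.1 hi with hi | rfl
    · rw [hupd i hi]
      have := e2 i hi
      dsimp only at this
      rw [hz'k i hi] at this
      exact this.trans ((hk _).mul_left e)
    · rw [Function.update_self]
      exact e3.trans ((hk _).mul_left e)

end AmalgamationSystem

/-! ### Automatic continuity of separable lengths. -/

/-- `ℓ` is symmetric and subadditive, and `Γ` is separable for the pseudometric `ℓ (g⁻¹ * h)`. -/
structure IsSeparableLength {Γ : Type*} [Group Γ] (ℓ : Γ → ℝ) : Prop where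
  mul_le : ∀ g h, ℓ (g * h) ≤ ℓ g + ℓ h
  inv_eq : ∀ g, ℓ g⁻¹ = ℓ g
  separable : ∀ ε > 0, ∃ k : ℕ → Γ, ∀ g, ∃ i, ℓ ((k i)⁻¹ * g) < ε

namespace AmalgamationSystem

open scoped Pointwise

variable {Γ X : Type*} [Group Γ] [MulAction Γ X] {F : Set (Set X)}

/-- `T` is nonmeager in every nonempty open subset of the pointwise stabilizer of `B`. -/
def EverywhereNonmeager (F : Set (Set X)) (B : Set X) (T : Set Γ) : Prop :=
  ∀ R, IsComeager F R → ∀ g : Γ, AgreeOn B g 1 → ∀ A ∈ F, ∃ y ∈ T, y ∈ R ∧ AgreeOn A y g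

theorem EverywhereNonmeager.mul_left {B : Set X} {T : Set Γ} (hT : EverywhereNonmeager F B T)
    {k : Γ} (hk : AgreeOn B k 1) : EverywhereNonmeager F B {g | k⁻¹ * g ∈ T} := by
  intro R hR g hg A hA
  have hkg : AgreeOn B (k⁻¹ * g) 1 := by
    rw [← agreeOn_mul_left_iff (k := k)]
    simpa using hg.trans hk.symm
  obtain ⟨y, hyT, hyR, hy⟩ := hT _ (hR.preimage_mul_left k) _ hkg A hA
  exact ⟨k * y, by simpa using hyT, hyR, by simpa using hy.mul_left k⟩

/-- Otherwise, for each `i`, every basic open set contains a smaller one in which `T i` misses a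
comeager set. For fixed `i` the smaller sets have dense union. With `u` restricted to a countable
dense set, Baire category gives a point of all these unions and all these comeager sets, and it lies
in no `T i`. -/
theorem exists_nonmeager_of_iUnion (S : AmalgamationSystem Γ F) {T : ℕ → Set Γ}
    (hT : ∀ g, ∃ i, g ∈ T i) : ∃ i, ∃ u : Γ, ∃ B ∈ F, ∀ R, IsComeager F R → ∀ g : Γ,
      AgreeOn B g u → ∀ A ∈ F, ∃ y ∈ T i, y ∈ R ∧ AgreeOn A y g := by
  by_contra! H
  obtain ⟨K, hK, hKF⟩ := S.separable
  have := S.countable.to_subtype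
  have := hK.to_subtype
  choose R hR g hg A hA hRA using H
  have hU : ∀ i, IsOpenDense F {y : Γ | ∃ (u : K) (B : F),
      AgreeOn (A i u B B.2) y (g i u B B.2)} := by
    intro i
    constructor
    · rintro y ⟨u, B, hy⟩
      exact ⟨A i u B B.2, hA i u B B.2, fun h hh => ⟨u, B, hh.trans hy⟩⟩
    · intro y B hB
      obtain ⟨u, hu, huy⟩ := hKF y B hB
      exact ⟨g i u B hB, ⟨⟨u, hu⟩, ⟨B, hB⟩, AgreeOn.refl _ _⟩, (hg i u B hB).trans huy⟩
  have hR' : ∀ t : ℕ × K × F, IsComeager F (R t.1 t.2.1 t.2.2 t.2.2.2) :=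
    fun t => hR t.1 t.2.1 t.2.2 t.2.2.2
  obtain ⟨A₀, hA₀, -⟩ := S.exists_bot
  obtain ⟨y, ⟨hy1, hy2⟩, -⟩ := S.exists_mem_of_isComeager
    ((IsComeager.iInter fun i => (hU i).isComeager).inter (IsComeager.iInter hR')) 1 hA₀
  rw [Set.mem_iInter] at hy1 hy2
  obtain ⟨i, hi⟩ := hT y
  obtain ⟨u, B, hyu⟩ := hy1 i
  exact hRA i u B B.2 y hi (hy2 (i, u, B)) hyu

/-- Some ball of radius `ε` is nonmeager throughout a basic open set. Translating by the inverse of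
one of its elements moves this open set to a stabilizer, and quotients of two elements of the ball
have length below `2 * ε`. -/
theorem exists_everywhereNonmeager (S : AmalgamationSystem Γ F) {ℓ : Γ → ℝ}
    (hℓ : IsSeparableLength ℓ) {ε : ℝ} (hε : 0 < ε) :
    ∃ B ∈ F, EverywhereNonmeager F B {g : Γ | ℓ g < 2 * ε} := by
  obtain ⟨k, hk⟩ := hℓ.separable ε hε
  obtain ⟨i, u, B, hB, H⟩ := S.exists_nonmeager_of_iUnion (T := fun i => {g | ℓ ((k i)⁻¹ * g) < ε}) hk
  obtain ⟨y₀, hy₀, -, hy₀u⟩ := H _ IsComeager.univ u (AgreeOn.refl _ _) B hB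
  refine ⟨B, hB, fun R hR g hg A hA => ?_⟩
  obtain ⟨y, hy, hyR, hyg⟩ := H _ (hR.preimage_mul_left y₀⁻¹) (y₀ * g)
    ((hg.mul_left y₀).trans (by simpa using hy₀u)) A hA
  refine ⟨y₀⁻¹ * y, ?_, hyR, by simpa using hyg.mul_left y₀⁻¹⟩
  have h1 := hℓ.mul_le ((k i)⁻¹ * y₀)⁻¹ ((k i)⁻¹ * y)
  rw [hℓ.inv_eq] at h1
  have h2 : ((k i)⁻¹ * y₀)⁻¹ * ((k i)⁻¹ * y) = y₀⁻¹ * y := by group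
  rw [h2] at h1
  simp only [Set.mem_ofPred_eq] at hy hy₀ ⊢
  linarith

/-- Splitting a node of the tree of conjugating elements. -/
theorem Generic.exists_split (S : AmalgamationSystem Γ F) {B : Set X} (hB : B ∈ F) {T₀ T₁ : Set Γ}
    (hT₀ : EverywhereNonmeager F B T₀) (hT₁ : EverywhereNonmeager F B T₁) {n : ℕ} {x : ℕ → Γ}
    (hx : Generic F n x) {A : Set X} (hA : A ∈ F) :
    ∃ y₀ ∈ T₀, ∃ y₁ ∈ T₁, Generic F (n + 1) (Function.update x n y₀) ∧
      Generic F (n + 1) (Function.update x n y₁) ∧ ∃ f : Γ, AgreeOn A f 1 ∧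
        (∀ i < n, f * x i = x i * f) ∧ f * y₁ = y₀ * f := by
  obtain ⟨D, hD, d1, d2⟩ := S.directed A hA B hB
  obtain ⟨E, hE, e1, e2⟩ := hx.cofinal D hD
  -- Both new entries are taken to fix the `x`-invariant set `E` pointwise, so the two continued
  -- tuples agree on `E` and are conjugate over it.
  obtain ⟨y₀, h₀, g₀, a₀⟩ := hT₀ _ (hx.isComeager_update S) 1 (AgreeOn.refl _ _) E hE
  obtain ⟨y₁, h₁, g₁, a₁⟩ := hT₁ _ (hx.isComeager_update S) 1 (AgreeOn.refl _ _) E hE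
  have hupd : ∀ (y : Γ) (i), i < n → Function.update x n y i = x i := fun y i hi =>
    Function.update_of_ne (by omega) _ _
  obtain ⟨f, hf, hfx⟩ := Generic.exists_conj S g₁ g₀ hE (fun i hi => by
    rcases Nat.lt_succ_iff_lt_or_eq.1 hi with hi | rfl
    · rw [hupd _ i hi, e2 i hi]
    · rw [Function.update_self, a₁.smul_eq, one_smul]) (fun i hi => by
    rcases Nat.lt_succ_iff_lt_or_eq.1 hi with hi | rfl
    · rw [hupd _ i hi, hupd _ i hi]
      exact AgreeOn.refl _ _
    · rw [Function.update_self, Function.update_self]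
      exact a₁.trans a₀.symm)
  refine ⟨y₀, h₀, y₁, h₁, g₀, g₁, f, hf.mono (d1.trans e1), fun i hi => ?_, ?_⟩
  · have := hfx i (by omega)
    rwa [hupd _ i hi, hupd _ i hi] at this
  · have := hfx n (by omega)
    rwa [Function.update_self, Function.update_self] at this

/-- The nodes of level `n` of the tree of conjugating elements: a generic tuple, a group element
and a member of `F`. -/
structure Node (Γ : Type*) {X : Type*} [Group Γ] [MulAction Γ X] (F : Set (Set X)) (n : ℕ) where
  tuple : ℕ → Γ
  elt : Γ
  supp : Set X
  generic : Generic F n tuple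
  supp_mem : supp ∈ F

/-- The conjugate of the `i`-th entry of the tuple of a node by its group element. -/
def Node.conj {n : ℕ} (s : Node Γ F n) (i : ℕ) : Γ := s.elt * s.tuple i * s.elt⁻¹

/-- The left child keeps the group element and the right child multiplies it by the conjugating `f`.
Since `f` commutes with the old entries and conjugates `y₁` to `y₀`, old conjugates do not change
and the two new ones coincide. The supports absorb `C` in both domain and range, so that limits
along branches exist. -/
theorem Node.exists_children (S : AmalgamationSystem Γ F) {B : Set X} (hB : B ∈ F)
    {T₀ T₁ : Set Γ} (hT₀ : EverywhereNonmeager F B T₀) (hT₁ : EverywhereNonmeager F B T₁) {n : ℕ}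
    (s : Node Γ F n) {C : Set X} (hC : C ∈ F) :
    ∃ t : Bool → Node Γ F (n + 1), (∀ b, (∀ i < n, (t b).tuple i = s.tuple i) ∧
      (∀ i < n, (t b).conj i = s.conj i) ∧ AgreeOn s.supp (t b).elt s.elt ∧
      s.supp ⊆ (t b).supp ∧ C ⊆ (t b).supp ∧ C ⊆ (t b).elt • (t b).supp) ∧
      (t false).tuple n ∈ T₀ ∧ (t true).tuple n ∈ T₁ ∧ (t false).conj n = (t true).conj n := by
  obtain ⟨y₀, h₀, y₁, h₁, g₀, g₁, f, hf, hfx, hfy⟩ := s.generic.exists_split S hB hT₀ hT₁ s.supp_mem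
  have key : ∀ h : Γ, ∃ D ∈ F, s.supp ⊆ D ∧ C ⊆ D ∧ C ⊆ h • D := by
    intro h
    obtain ⟨D, hD, d1, d2, d3⟩ := S.directed₃ s.supp_mem hC (S.smul_mem h⁻¹ C hC)
    exact ⟨D, hD, d1, d2, by rwa [Set.subset_smul_set_iff]⟩
  obtain ⟨D₀, hD₀, a1, a2, a3⟩ := key s.elt
  obtain ⟨D₁, hD₁, b1, b2, b3⟩ := key (s.elt * f)
  have hupd : ∀ (y : Γ) (i), i < n → Function.update s.tuple n y i = s.tuple i := fun y i hi =>
    Function.update_of_ne (by omega) _ _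
  let t₀ : Node Γ F (n + 1) := ⟨Function.update s.tuple n y₀, s.elt, D₀, g₀, hD₀⟩
  let t₁ : Node Γ F (n + 1) := ⟨Function.update s.tuple n y₁, s.elt * f, D₁, g₁, hD₁⟩
  refine ⟨fun b => bif b then t₁ else t₀, ?_, ?_, ?_, ?_⟩
  · rintro (_ | _)
    · exact ⟨fun i hi => hupd _ i hi, fun i hi => by simp [t₀, Node.conj, hupd _ i hi],
        AgreeOn.refl _ _, a1, a2, a3⟩
    · refine ⟨fun i hi => hupd _ i hi, fun i hi => ?_, ?_, b1, b2, b3⟩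
      · simp only [cond_true, t₁, Node.conj, hupd _ i hi, mul_assoc, mul_inv_rev]
        rw [← mul_assoc f, hfx i hi]
        simp [mul_assoc]
      · simpa using hf.mul_left s.elt
  · simpa [t₀] using h₀
  · simpa [t₁] using h₁
  · simp only [cond_true, cond_false, t₀, t₁, Node.conj, Function.update_self, mul_assoc,
      mul_inv_rev]
    rw [← mul_assoc f, hfy]
    simp [mul_assoc]

/-- A perfect tree of group elements `h α`, any two of which conjugate some element of `T₀` and some
element of `T₁` to the same element. -/
theorem exists_conjugating_tree (S : AmalgamationSystem Γ F) {B : Set X} (hB : B ∈ F)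
    {T₀ T₁ : Set Γ} (hT₀ : EverywhereNonmeager F B T₀) (hT₁ : EverywhereNonmeager F B T₁) :
    ∃ h : (ℕ → Bool) → Γ, ∀ (α β : ℕ → Bool) (n : ℕ), (∀ i < n, α i = β i) → α n = false →
      β n = true → ∃ a ∈ T₀, ∃ b ∈ T₁, h α * a * (h α)⁻¹ = h β * b * (h β)⁻¹ := by
  obtain ⟨C, hCF, hC⟩ := S.exists_enumeration
  choose t ht h₀ h₁ hconj using fun n (s : Node Γ F n) =>
    s.exists_children S hB hT₀ hT₁ (hCF n)
  let s₀ : Node Γ F 0 := ⟨1, 1, B, generic_zero F 1, hB⟩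
  let s : (ℕ → Bool) → (n : ℕ) → Node Γ F n := fun α n => Nat.rec s₀ (fun n p => t n p (α n)) n
  have hs : ∀ α n, s α (n + 1) = t n (s α n) (α n) := fun _ _ => rfl
  have hss : ∀ (α β : ℕ → Bool) n, (∀ i < n, α i = β i) → s α n = s β n := by
    intro α β n
    induction n with
    | zero => intro _; rfl
    | succ n ih =>
      intro H
      rw [hs, hs, ih fun i hi => H i (by omega), H n (by omega)]
  have hmono : ∀ α, Monotone fun n => (s α n).supp := fun α =>
    monotone_nat_of_le_succ fun n => (ht n (s α n) (α n)).2.2.2.1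
  have hcof : ∀ α, ∀ D ∈ F, ∃ n, D ⊆ (s α n).supp ∧ D ⊆ (s α n).elt • (s α n).supp := by
    intro α D hD
    obtain ⟨n, rfl⟩ := hC D hD
    exact ⟨n + 1, (ht n (s α n) (α n)).2.2.2.2⟩
  choose h hh using fun α => S.complete (fun n => (s α n).supp) (fun n => (s α n).elt)
    (fun n => (s α n).supp_mem) (hmono α) (fun n => (ht n (s α n) (α n)).2.2.1) (hcof α)
  have key : ∀ α n, h α * (s α (n + 1)).tuple n * (h α)⁻¹ = (s α (n + 1)).conj n := by
    intro α n
    rw [mul_inv_eq_iff_eq_mul]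
    have hconst : ∀ m, n + 1 ≤ m → (s α m).tuple n = (s α (n + 1)).tuple n ∧
        (s α m).conj n = (s α (n + 1)).conj n := by
      intro m hm
      induction m, hm using Nat.le_induction with
      | base => exact ⟨rfl, rfl⟩
      | succ m hm ih =>
        rw [hs α m]
        exact ⟨((ht m (s α m) (α m)).1 n hm).trans ih.1,
          ((ht m (s α m) (α m)).2.1 n hm).trans ih.2⟩
    -- Comparing the two products on `A` involves the values of `h α` on `A` and on `x • A`; a late
    -- support contains both, and there `h α` is the element of the node.
    refine S.faithful _ _ fun A hA => ?_
    set x := (s α (n + 1)).tuple n with hx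
    obtain ⟨D, hD, d1, d2⟩ := S.directed A hA _ (S.smul_mem x A hA)
    obtain ⟨m, hm, -⟩ := hcof α D hD
    have hm' : D ⊆ (s α (max m (n + 1))).supp := hm.trans (hmono α (le_max_left _ _))
    obtain ⟨c1, c2⟩ := hconst _ (le_max_right m (n + 1))
    set p := s α (max m (n + 1)) with hp
    have hhp : AgreeOn p.supp (h α) p.elt := hh α _
    intro a ha
    have e1 : (h α) • x • a = p.elt • x • a := hhp _ (hm' (d2 (Set.smul_mem_smul_set ha)))
    have e2 : (h α) • a = p.elt • a := hhp _ (hm' (d1 ha))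
    rw [mul_smul, mul_smul, e1, e2, ← c2, Node.conj, c1, ← mul_smul, ← mul_smul]
    simp
  refine ⟨h, fun α β n hαβ hα hβ => ⟨(s α (n + 1)).tuple n, ?_, (s β (n + 1)).tuple n, ?_, ?_⟩⟩
  · rw [hs, hα]
    exact h₀ n _
  · rw [hs, hβ]
    exact h₁ n _
  · rw [key, key, hs, hs, hα, hβ, hss α β n hαβ]
    exact hconj n _

/-- A separable length function is continuous at the identity for the topology of pointwise
convergence on members of `F`. -/
theorem exists_forall_length_le (S : AmalgamationSystem Γ F) {ℓ : Γ → ℝ}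
    (hℓ : IsSeparableLength ℓ) {ε : ℝ} (hε : 0 < ε) :
    ∃ B ∈ F, ∀ g : Γ, AgreeOn B g 1 → ℓ g ≤ ε := by
  -- The final estimate adds four quantities of size at most `ε / 4`: the lengths of `a` and of `g⁻¹
  -- * b`, and twice that of the conjugator, which is a quotient of two elements of one ball of
  -- radius `ε / 8`.
  obtain ⟨B, hB, hBT⟩ := S.exists_everywhereNonmeager hℓ (show 0 < ε / 8 by positivity)
  refine ⟨B, hB, fun g hg => ?_⟩
  obtain ⟨h, hh⟩ := S.exists_conjugating_tree hB hBT (hBT.mul_left hg)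
  obtain ⟨k, hk⟩ := hℓ.separable (ε / 8) (by positivity)
  choose i hi using hk
  -- There are uncountably many branches and only countably many balls.
  have hninj : ¬ Function.Injective fun α => i (h α) := fun hinj =>
    Function.cantor_injective _ (hinj.comp (g := fun α => i (h α)) (f := Set.boolIndicator)
      fun s t hst => Set.ext fun n => by
        rw [s.mem_iff_boolIndicator, t.mem_iff_boolIndicator, hst])
  obtain ⟨α, β, hαβ, hne⟩ : ∃ α β, i (h α) = i (h β) ∧ α ≠ β := by
    simpa [Function.Injective] using hninj
  obtain ⟨n, hn, hlt⟩ : ∃ n, α n ≠ β n ∧ ∀ m < n, α m = β m := by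
    have hex : ∃ n, α n ≠ β n := Function.ne_iff.1 hne
    exact ⟨Nat.find hex, Nat.find_spec hex, fun m hm => not_not.1 (Nat.find_min hex hm)⟩
  obtain ⟨α, β, hαβ, hlt, hα, hβ⟩ : ∃ α β : ℕ → Bool, i (h α) = i (h β) ∧ (∀ m < n, α m = β m) ∧
      α n = false ∧ β n = true := by
    cases hα : α n <;> cases hβ : β n
    · simp [hα, hβ] at hn
    · exact ⟨α, β, hαβ, hlt, hα, hβ⟩
    · exact ⟨β, α, hαβ.symm, fun m hm => (hlt m hm).symm, hβ, hα⟩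
    · simp [hα, hβ] at hn
  obtain ⟨a, ha, b, hb, hab⟩ := hh α β n hlt hα hβ
  have h1 : ℓ ((h β)⁻¹ * h α) ≤ ε / 8 + ε / 8 := by
    have := hℓ.mul_le ((k (i (h β)))⁻¹ * h β)⁻¹ ((k (i (h β)))⁻¹ * h α)
    rw [hℓ.inv_eq, show ((k (i (h β)))⁻¹ * h β)⁻¹ * ((k (i (h β)))⁻¹ * h α) = (h β)⁻¹ * h α by
      group] at this
    have e1 := hi (h α)
    have e2 := hi (h β)
    rw [hαβ] at e1
    linarith
  have hb' : b = ((h β)⁻¹ * h α) * a * ((h β)⁻¹ * h α)⁻¹ := by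
    calc b = (h β)⁻¹ * (h β * b * (h β)⁻¹) * h β := by group
      _ = _ := by rw [← hab]; group
  have h2 : ℓ b ≤ ℓ ((h β)⁻¹ * h α) + ℓ a + ℓ ((h β)⁻¹ * h α) := by
    have e1 := hℓ.mul_le (((h β)⁻¹ * h α) * a) ((h β)⁻¹ * h α)⁻¹
    have e2 := hℓ.mul_le ((h β)⁻¹ * h α) a
    rw [hℓ.inv_eq] at e1
    rw [← hb'] at e1
    linarith
  have h3 : ℓ g ≤ ℓ b + ℓ (g⁻¹ * b) := by
    have := hℓ.mul_le b (g⁻¹ * b)⁻¹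
    rwa [hℓ.inv_eq, show b * (g⁻¹ * b)⁻¹ = g by group] at this
  simp only [Set.mem_ofPred_eq] at ha hb
  linarith

end AmalgamationSystem

/-! ### Triviality of homomorphisms from an amalgamation system. -/

namespace AmalgamationSystem

open scoped Pointwise Topology
open Filter

variable {Γ X : Type*} [Group Γ] [MulAction Γ X] {F : Set (Set X)}

theorem isSeparableLength_dist {H : Type*} [Group H] [MetricSpace H]
    [TopologicalSpace.SeparableSpace H] (hd : ∀ g x y : H, dist (g * x) (g * y) = dist x y)
    (φ : Γ →* H) : IsSeparableLength fun g => dist (φ g) 1 := by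
  have hquot : ∀ g h : Γ, dist (φ (g⁻¹ * h)) 1 = dist (φ h) (φ g) := fun g h => by
    rw [← hd (φ g), map_mul, map_inv, mul_inv_cancel_left, mul_one]
  refine ⟨fun g h => ?_, fun g => ?_, fun ε hε => ?_⟩
  · refine (dist_triangle _ (φ g) _).trans ?_
    rw [map_mul, ← hd (φ g) (φ h) 1, mul_one, add_comm]
  · have := hquot g 1
    rw [mul_one, map_one, dist_comm 1] at this
    exact this
  -- A dense sequence in the range of `φ`, rather than in `H`, has centres that lift to `Γ`.
  · have : Nonempty (Set.range φ) := ⟨⟨1, 1, map_one φ⟩⟩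
    have : ∀ n, ∃ g, φ g = TopologicalSpace.denseSeq (Set.range φ) n := fun n =>
      (TopologicalSpace.denseSeq (Set.range φ) n).2
    choose k hk using this
    refine ⟨k, fun g => ?_⟩
    obtain ⟨i, hi⟩ := (TopologicalSpace.denseRange_denseSeq (Set.range φ)).exists_dist_lt
      ⟨φ g, g, rfl⟩ hε
    refine ⟨i, ?_⟩
    rw [hquot, hk]
    exact hi

/-- An element leaving `B` invariant can be modified off `B` so as to have small image under a
homomorphism to a group with a complete left-invariant metric. -/
theorem exists_agreeOn_dist_lt (S : AmalgamationSystem Γ F) {H : Type*} [Group H] [MetricSpace H]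
    [IsTopologicalGroup H] [CompleteSpace H]
    (hd : ∀ g x y : H, dist (g * x) (g * y) = dist x y) (φ : Γ →* H)
    (hφ : ∀ ε > 0, ∃ B ∈ F, ∀ g : Γ, AgreeOn B g 1 → dist (φ g) 1 ≤ ε) {B : Set X} (hB : B ∈ F)
    {g : Γ} (hg : g • B = B) {ε : ℝ} (hε : 0 < ε) : ∃ g', AgreeOn B g' g ∧ dist (φ g') 1 < ε := by
  obtain ⟨A₀, hA₀, hbot, hfix⟩ := S.exists_bot
  choose C hCF hC using fun n : ℕ => hφ ((1 / 2) ^ n) (by positivity)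
  have hstep : ∀ n (A : F), ∃ A' : F, (A : Set X) ⊆ A' ∧ C n ⊆ A' := fun n A => by
    obtain ⟨D, hD, h⟩ := S.directed A A.2 (C n) (hCF n)
    exact ⟨⟨D, hD⟩, h⟩
  choose next hnext hnextC using hstep
  let A : ℕ → F := fun n => Nat.rec (motive := fun _ => F) ⟨A₀, hA₀⟩ next n
  have hA : ∀ n, (A n : Set X) ⊆ (A (n + 1) : Set X) := fun n => hnext n (A n)
  have hsmall : ∀ n (k : Γ), AgreeOn (A (n + 1) : Set X) k 1 → dist (φ k) 1 ≤ (1 / 2) ^ n :=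
    fun n k hk => hC n k (hk.mono (hnextC n (A n)))
  -- In a state `(h, D, u)` the element `u` leaves `D` invariant, extends `g` on `B`, and fixes the
  -- moved copy `h • A n` inside `D`.
  let P : ℕ → Γ × Set X × Γ → Prop := fun n s => s.2.1 ∈ F ∧ s.2.2 • s.2.1 = s.2.1 ∧ B ⊆ s.2.1 ∧
    AgreeOn B s.2.2 g ∧ s.1 • (A n : Set X) ⊆ s.2.1 ∧ AgreeOn (s.1 • (A n : Set X)) s.2.2 1
  have step : ∀ n s, P n s → ∃ s', P (n + 1) s' ∧ AgreeOn (A n : Set X) s'.1 s.1 := by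
    rintro n ⟨h, D, u⟩ ⟨h1, h2, h3, h4, h5, h6⟩
    dsimp only at h1 h2 h3 h4 h5 h6
    -- Over `h • A n`, where `u` is the identity, `u` on `D` is amalgamated with the identity on `h
    -- • A (n + 1)`. Since `k` fixes `h • A n`, passing from `h` to `k * h` changes nothing on `A
    -- n`.
    obtain ⟨k, hk, E, hE, hDE, hkE, ham⟩ := S.amalgamation (h • (A n : Set X))
      (S.smul_mem h _ (A n).2) D h1 (h • (A (n + 1) : Set X)) (S.smul_mem h _ (A (n + 1)).2) h5
      (Set.smul_set_mono (hA n))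
    obtain ⟨u', e1, e2, e3⟩ := ham u 1 h2 (one_smul _ _) (by rw [h6.smul_eq, one_smul]) h6
    refine ⟨(k * h, E, u'), ⟨hE, e1, h3.trans hDE, (e2.mono h3).trans h4, ?_, ?_⟩, ?_⟩
    · simpa [mul_smul] using hkE
    · simpa [mul_smul] using e3
    · simpa using agreeOn_smul_iff.1 hk
  choose! nx hnx hnx' using step
  let s : ℕ → Γ × Set X × Γ := fun n => Nat.rec (1, B, g) nx n
  have hs : ∀ n, P n (s n) := by
    intro n
    induction n with
    | zero =>
      refine ⟨hB, hg, subset_rfl, AgreeOn.refl _ _, ?_, ?_⟩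
      · simpa [s, A] using hbot B hB
      · simpa [s, A] using hfix g
    | succ n ih => exact hnx n _ ih
  have hs' : ∀ n, AgreeOn (A n : Set X) (s (n + 1)).1 (s n).1 := fun n => hnx' n _ (hs n)
  have hdist : ∀ n, dist (φ (s (n + 1)).1) (φ (s (n + 2)).1) ≤ (1 / 2) ^ n := by
    intro n
    rw [dist_comm, ← hd (φ (s (n + 1)).1)⁻¹, inv_mul_cancel, ← map_inv, ← map_mul]
    refine hsmall n _ ?_
    have := (hs' (n + 1)).mul_left (s (n + 1)).1⁻¹
    rwa [inv_mul_cancel] at this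
  have hcau : CauchySeq fun n => φ (s (n + 1)).1 := by
    refine cauchySeq_of_le_geometric (1 / 2) 1 (by norm_num) fun n => ?_
    rw [one_mul]
    exact hdist n
  obtain ⟨y, hy⟩ := cauchySeq_tendsto_of_complete hcau
  have hconj : Tendsto (fun n => φ ((s (n + 1)).1⁻¹ * (s (n + 1)).2.2 * (s (n + 1)).1)) atTop
      (𝓝 1) := by
    rw [tendsto_iff_dist_tendsto_zero]
    refine squeeze_zero (fun _ => dist_nonneg) (fun n => hsmall n _ ?_)
      (tendsto_pow_atTop_nhds_zero_of_lt_one (r := (1 / 2 : ℝ)) (by norm_num) (by norm_num))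
    have := (agreeOn_smul_iff.1 (hs (n + 1)).2.2.2.2.2).mul_left (s (n + 1)).1⁻¹
    simpa [mul_assoc] using this
  -- If `φ h` tends to `y` and the image of `h⁻¹ * u * h` to `1`, then `φ u` tends to `y * 1 * y⁻¹`.
  have hlim : Tendsto (fun n => φ (s (n + 1)).2.2) atTop (𝓝 1) := by
    have := (hy.mul hconj).mul hy.inv
    rw [mul_one, mul_inv_cancel] at this
    refine this.congr fun n => ?_
    rw [← map_inv, ← map_mul, ← map_mul]
    congr 1
    group
  obtain ⟨n, hn⟩ := ((tendsto_iff_dist_tendsto_zero.1 hlim).eventually_lt_const hε).exists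
  exact ⟨(s (n + 1)).2.2, (hs (n + 1)).2.2.2.1, hn⟩

/-- Homomorphisms from `Γ` to a separable group with a complete left-invariant metric are trivial. -/
theorem map_eq_one (S : AmalgamationSystem Γ F) {H : Type*} [Group H] [MetricSpace H]
    [IsTopologicalGroup H] [CompleteSpace H] [TopologicalSpace.SeparableSpace H]
    (hd : ∀ g x y : H, dist (g * x) (g * y) = dist x y) (φ : Γ →* H) (g : Γ) : φ g = 1 := by
  have hℓ := isSeparableLength_dist hd φ
  have hφ : ∀ ε > 0, ∃ B ∈ F, ∀ g : Γ, AgreeOn B g 1 → dist (φ g) 1 ≤ ε :=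
    fun ε hε => S.exists_forall_length_le hℓ hε
  refine dist_le_zero.1 (le_of_forall_pos_le_add fun ε hε => ?_)
  obtain ⟨A, hA, hAε⟩ := hφ (ε / 2) (by positivity)
  -- Replacing `g` by an `h` that agrees with it on `A` and leaves some `N` invariant costs only an
  -- element fixing `A`, whose image is within `ε / 2` of `1`.
  obtain ⟨N, hN, hAN, h, hh⟩ := S.locallyFinite A hA 1 fun _ => g
  obtain ⟨h1, h2⟩ := hh 0 one_pos
  obtain ⟨g', hg', hlt⟩ := S.exists_agreeOn_dist_lt hd φ hφ hN h2 (show 0 < ε / 2 by positivity)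
  have h3 : AgreeOn A (g'⁻¹ * g) 1 := by
    have := (((hg'.mono hAN).trans h1).mul_left g'⁻¹).symm
    simpa using this
  have h4 := hℓ.mul_le g' (g'⁻¹ * g)
  have h5 := hAε _ h3
  rw [mul_inv_cancel_left] at h4
  linarith

end AmalgamationSystem

/-! ### Finitely generated substructures and automorphisms. -/

namespace MetricStructure

open scoped Pointwise

variable {L : MetricSignature} {X : Type u} [MetricSpace X] {M : MetricStructure L X}

instance instMulActionAut : MulAction M.Aut X where
  smul g x := (g : X ≃ᵢ X) x
  one_smul _ := rfl
  mul_smul _ _ _ := rfl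

theorem func_smul (g : M.Aut) (f : L.Func) (x : Fin (L.domX f) → X) (r : Fin (L.domR f) → ℝ) :
    M.func f (fun i => g • x i) r = (fun i => g • (M.func f x r).1 i, (M.func f x r).2) :=
  g.2.1 f x r

theorem rel_smul_iff (g : M.Aut) (R : L.Rel) (x : Fin (L.relX R) → X) (r : Fin (L.relR R) → ℝ) :
    ((fun i => g • x i), r) ∈ M.rel R ↔ (x, r) ∈ M.rel R :=
  g.2.2 R x r

theorem dist_aut_smul (g : M.Aut) (x y : X) : dist (g • x) (g • y) = dist x y :=
  (g : X ≃ᵢ X).dist_eq x y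

namespace Substructure

theorem ext_of_eq {A B : M.Substructure} (hp : A.pts = B.pts) (hr : A.reals = B.reals) : A = B := by
  cases A
  cases B
  simp only at hp hr
  subst hp hr
  rfl

theorem IsContainedIn.antisymm {A B : M.Substructure} (h : A.IsContainedIn B)
    (h' : B.IsContainedIn A) : A = B :=
  ext_of_eq (h.1.antisymm h'.1) (h.2.antisymm h'.2)

theorem subset_generate (M : MetricStructure L X) (S : Set X) (T : Set ℝ) :
    S ⊆ (generate M S T).pts := fun _ hx _ hS _ => hS hx

theorem generate_isContainedIn {S : Set X} {T : Set ℝ} {N : M.Substructure} (hS : S ⊆ N.pts)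
    (hT : T ⊆ N.reals) : (generate M S T).IsContainedIn N :=
  ⟨fun _ hx => hx N hS hT, fun _ hr => hr N hS hT⟩

/-- The generators are points only, so the reals of a finitely generated substructure come from its
points. This allows working with the sets in `fgSets` instead of two-sorted substructures. -/
theorem IsFG.isContainedIn {A B : M.Substructure} (hA : A.IsFG) (h : A.pts ⊆ B.pts) :
    A.IsContainedIn B := by
  obtain ⟨S, -, rfl⟩ := hA
  exact generate_isContainedIn ((subset_generate M S ∅).trans h) (Set.empty_subset _)

theorem isFG_generate {S : Set X} (hS : S.Finite) : (generate M S ∅).IsFG := ⟨S, hS, rfl⟩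

theorem IsFG.join {A B : M.Substructure} (hA : A.IsFG) (hB : B.IsFG) : (join A B).IsFG := by
  obtain ⟨S, hS, rfl⟩ := hA
  obtain ⟨T, hT, rfl⟩ := hB
  refine ⟨S ∪ T, hS.union hT, ?_⟩
  have h1 : (generate M S ∅).IsContainedIn (generate M (S ∪ T) ∅) :=
    generate_isContainedIn (Set.subset_union_left.trans (subset_generate M _ _))
      (Set.empty_subset _)
  have h2 : (generate M T ∅).IsContainedIn (generate M (S ∪ T) ∅) :=
    generate_isContainedIn (Set.subset_union_right.trans (subset_generate M _ _))
      (Set.empty_subset _)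
  refine IsContainedIn.antisymm
    (generate_isContainedIn (Set.union_subset h1.1 h2.1) (Set.union_subset h1.2 h2.2))
    (generate_isContainedIn (Set.union_subset ?_ ?_) (Set.empty_subset _))
  · exact (subset_generate M S ∅).trans (Set.subset_union_left.trans (subset_generate M _ _))
  · exact (subset_generate M T ∅).trans (Set.subset_union_right.trans (subset_generate M _ _))

/-- The image of a substructure under an automorphism. -/
def map (g : M.Aut) (A : M.Substructure) : M.Substructure where
  pts := g • A.pts
  reals := A.reals
  dist_mem x hx y hy := by
    rw [Set.mem_smul_set_iff_inv_smul_mem] at hx hy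
    rw [← dist_aut_smul g⁻¹]
    exact A.dist_mem _ hx _ hy
  funcX_mem f x r hx hr i := by
    simp only [Set.mem_smul_set_iff_inv_smul_mem] at hx ⊢
    have := A.funcX_mem f _ r hx hr i
    rwa [func_smul] at this
  funcR_mem f x r hx hr i := by
    simp only [Set.mem_smul_set_iff_inv_smul_mem] at hx
    have := A.funcR_mem f _ r hx hr i
    rwa [func_smul] at this

theorem IsFG.map {A : M.Substructure} (hA : A.IsFG) (g : M.Aut) : (A.map g).IsFG := by
  obtain ⟨S, hS, rfl⟩ := hA
  refine ⟨g • S, hS.smul_set, IsContainedIn.antisymm ?_ ?_⟩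
  · have h : (generate M S ∅).IsContainedIn ((generate M (g • S) ∅).map g⁻¹) := by
      refine generate_isContainedIn ?_ (Set.empty_subset _)
      change S ⊆ g⁻¹ • (generate M (g • S) ∅).pts
      rw [Set.subset_smul_set_iff, inv_inv]
      exact subset_generate M _ _
    refine ⟨?_, h.2⟩
    change g • (generate M S ∅).pts ⊆ (generate M (g • S) ∅).pts
    have h1 : (generate M S ∅).pts ⊆ g⁻¹ • (generate M (g • S) ∅).pts := h.1
    rwa [Set.subset_smul_set_iff, inv_inv] at h1
  · exact generate_isContainedIn (Set.smul_set_mono (subset_generate M S ∅)) (Set.empty_subset _)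

/-- The isomorphism of substructures induced by an automorphism. -/
def isoOfAut (g : M.Aut) {A B : M.Substructure} (hp : g • A.pts = B.pts)
    (hr : A.reals = B.reals) : Iso A B where
  toEquiv :=
    { toFun := fun x => ⟨g • (x : X), hp ▸ Set.smul_mem_smul_set x.2⟩
      invFun := fun y => ⟨g⁻¹ • (y : X), by
        rw [← Set.mem_smul_set_iff_inv_smul_mem, hp]; exact y.2⟩
      left_inv := fun x => by simp
      right_inv := fun y => by simp }
  reals_eq := hr
  dist_eq x y := dist_aut_smul g _ _
  funcX_eq f x r _ i := congrFun (congrArg Prod.fst (func_smul g f _ r)) i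
  funcR_eq f x r _ i := congrFun (congrArg Prod.snd (func_smul g f _ r)) i
  rel_iff R x r _ := rel_smul_iff g R _ r

/-- Automorphisms that agree on generators agree on the generated substructure. -/
theorem agreeOn_generate {S : Set X} {g h : M.Aut} (H : AgreeOn S g h) :
    AgreeOn (generate M S ∅).pts g h := by
  let N : M.Substructure :=
    { pts := {x | g • x = h • x}
      reals := Set.univ
      dist_mem := fun _ _ _ _ => trivial
      funcX_mem := fun f x r hx _ i => by
        have h1 := congrFun (congrArg Prod.fst (func_smul g f x r)) i
        have h2 := congrFun (congrArg Prod.fst (func_smul h f x r)) i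
        rw [show (fun i => g • x i) = fun i => h • x i from funext hx] at h1
        exact h1.symm.trans h2
      funcR_mem := fun _ _ _ _ _ _ => trivial }
  exact fun x hx => hx N H (Set.empty_subset _)

end Substructure

open Substructure

/-- The sets of points of the finitely generated substructures. -/
def fgSets (M : MetricStructure L X) : Set (Set X) := {P | ∃ A : M.Substructure, A.IsFG ∧ A.pts = P}

theorem smul_mem_fgSets (g : M.Aut) {P : Set X} (hP : P ∈ M.fgSets) : g • P ∈ M.fgSets := by
  obtain ⟨A, hA, rfl⟩ := hP
  exact ⟨A.map g, hA.map g, rfl⟩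

theorem fgSets_directed {P Q : Set X} (hP : P ∈ M.fgSets) (hQ : Q ∈ M.fgSets) :
    ∃ R ∈ M.fgSets, P ⊆ R ∧ Q ⊆ R := by
  obtain ⟨A, hA, rfl⟩ := hP
  obtain ⟨B, hB, rfl⟩ := hQ
  exact ⟨_, ⟨_, hA.join hB, rfl⟩, Set.subset_union_left.trans (subset_generate M _ _),
    Set.subset_union_right.trans (subset_generate M _ _)⟩

theorem exists_mem_fgSets_bot (M : MetricStructure L X) :
    ∃ P ∈ M.fgSets, (∀ Q ∈ M.fgSets, P ⊆ Q) ∧ ∀ g : M.Aut, AgreeOn P g 1 := by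
  refine ⟨_, ⟨_, isFG_generate Set.finite_empty, rfl⟩, ?_, fun g =>
    agreeOn_generate fun _ h => h.elim⟩
  rintro _ ⟨A, -, rfl⟩
  exact (generate_isContainedIn (Set.empty_subset _) (Set.empty_subset _)).1

theorem exists_mem_fgSets_of_mem (M : MetricStructure L X) (x : X) : ∃ P ∈ M.fgSets, x ∈ P :=
  ⟨_, ⟨_, isFG_generate (Set.finite_singleton x), rfl⟩, subset_generate M _ _ rfl⟩

theorem IsHomogeneous.exists_aut (hM : M.IsHomogeneous) {A B : M.Substructure} (hA : A.IsFG)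
    (hB : B.IsFG) (φ : Iso A B) :
    ∃ g : M.Aut, (∀ x : A.pts, g • (x : X) = φ.toEquiv x) ∧ g • A.pts = B.pts := by
  obtain ⟨g, hg, hgφ⟩ := hM A B hA hB φ
  have H : ∀ x : A.pts, (⟨g, hg⟩ : M.Aut) • (x : X) = φ.toEquiv x := hgφ
  refine ⟨⟨g, hg⟩, H, Set.Subset.antisymm ?_ fun y hy => ?_⟩
  · rintro _ ⟨x, hx, rfl⟩
    change (⟨g, hg⟩ : M.Aut) • x ∈ _
    rw [H ⟨x, hx⟩]
    exact (φ.toEquiv ⟨x, hx⟩).2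
  · refine ⟨φ.toEquiv.symm ⟨y, hy⟩, (φ.toEquiv.symm ⟨y, hy⟩).2, ?_⟩
    change (⟨g, hg⟩ : M.Aut) • _ = y
    rw [H, Equiv.apply_symm_apply]

/-- Each `g` in the list restricts to a partial automorphism, from `A` to its image, of an `N`
containing `A` and all these images. Homogeneity turns the resulting automorphisms of `N'` into
automorphisms of the whole structure. -/
theorem HasLocallyFiniteAutomorphisms.exists_extension (hM : M.HasLocallyFiniteAutomorphisms)
    (hhom : M.IsHomogeneous) {P : Set X} (hP : P ∈ M.fgSets) (l : List M.Aut) :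
    ∃ Q ∈ M.fgSets, P ⊆ Q ∧ ∀ g ∈ l, ∃ h : M.Aut, AgreeOn P h g ∧ h • Q = Q := by
  obtain ⟨A, hA, rfl⟩ := hP
  obtain ⟨N, hN, hAN, hlN⟩ : ∃ N : M.Substructure, N.IsFG ∧ A.IsContainedIn N ∧
      ∀ g ∈ l, (A.map g).IsContainedIn N := by
    induction l with
    | nil => exact ⟨A, hA, ⟨subset_rfl, subset_rfl⟩, by simp⟩
    | cons g l ih =>
      obtain ⟨N, hN, h1, h2⟩ := ih
      have h3 : N.pts ⊆ (N.join (A.map g)).pts :=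
        Set.subset_union_left.trans (subset_generate M _ _)
      refine ⟨N.join (A.map g), hN.join (hA.map g), hA.isContainedIn (h1.1.trans h3), ?_⟩
      intro k hk
      rcases List.mem_cons.1 hk with rfl | hk
      · exact (hA.map _).isContainedIn (Set.subset_union_right.trans (subset_generate M _ _))
      · exact (hA.map _).isContainedIn ((h2 k hk).1.trans h3)
  obtain ⟨N', hN', hNN', hext⟩ := hM l.length N hN (fun _ => A) (fun i => A.map l[i])
    (fun _ => hA) (fun i => hA.map _) (fun _ => hAN) (fun i => hlN _ (List.getElem_mem _))
    (fun i => isoOfAut l[i] rfl rfl)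
  refine ⟨N'.pts, ⟨N', hN', rfl⟩, hAN.1.trans hNN'.1, fun g hg => ?_⟩
  obtain ⟨i, hi, rfl⟩ := List.getElem_of_mem hg
  obtain ⟨ψ, hψ⟩ := hext ⟨i, hi⟩
  obtain ⟨h, h1, h2⟩ := hhom.exists_aut hN' hN' ψ
  refine ⟨h, fun x hx => ?_, h2⟩
  obtain ⟨hx', e⟩ := hψ x hx
  exact (h1 ⟨x, hx'⟩).trans e


/-- An equivalence between the points of two substructures that preserves atomic formulas in which
arbitrary real constants may occur. -/
structure IsAtomicEquiv {C C' : M.Substructure} (e : C.pts ≃ C'.pts) : Prop where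
  dist_eq : ∀ x y : C.pts, dist (e x : X) (e y : X) = dist (x : X) (y : X)
  funcX_iff : ∀ (f : L.Func) (x : Fin (L.domX f) → C.pts) (r : Fin (L.domR f) → ℝ)
    (i : Fin (L.codX f)) (y : C.pts), (M.func f (fun j => (e (x j) : X)) r).1 i = e y ↔
      (M.func f (fun j => (x j : X)) r).1 i = y
  funcR_eq : ∀ (f : L.Func) (x : Fin (L.domX f) → C.pts) (r : Fin (L.domR f) → ℝ)
    (i : Fin (L.codR f)), (M.func f (fun j => (e (x j) : X)) r).2 i =
      (M.func f (fun j => (x j : X)) r).2 i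
  rel_iff : ∀ (R : L.Rel) (x : Fin (L.relX R) → C.pts) (r : Fin (L.relR R) → ℝ),
    ((fun j => (e (x j) : X)), r) ∈ M.rel R ↔ ((fun j => (x j : X)), r) ∈ M.rel R

namespace IsAtomicEquiv

variable {C C' : M.Substructure} {e : C.pts ≃ C'.pts}

theorem symm (h : IsAtomicEquiv e) : IsAtomicEquiv e.symm where
  dist_eq x y := by simpa using (h.dist_eq (e.symm x) (e.symm y)).symm
  funcX_iff f x r i y := by
    simpa using (h.funcX_iff f (fun j => e.symm (x j)) r i (e.symm y)).symm
  funcR_eq f x r i := by simpa using (h.funcR_eq f (fun j => e.symm (x j)) r i).symm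
  rel_iff R x r := by simpa using (h.rel_iff R (fun j => e.symm (x j)) r).symm

/-- The points of `C'` together with the reals of `C` are closed under the distance and all
functions, because `e` preserves atomic formulas. This substructure contains the generators of `C'`,
hence all of `C'`. -/
theorem reals_subset (h : IsAtomicEquiv e) (hC' : C'.IsFG) : C'.reals ⊆ C.reals := by
  let N : M.Substructure :=
    { pts := C'.pts
      reals := C.reals
      dist_mem := fun x hx y hy => by
        have := h.symm.dist_eq ⟨x, hx⟩ ⟨y, hy⟩
        dsimp only at this
        rw [← this]
        exact C.dist_mem _ (e.symm _).2 _ (e.symm _).2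
      funcX_mem := fun f x r hx hr i => by
        have hmem := C.funcX_mem f (fun j => (e.symm ⟨x j, hx j⟩ : X)) r (fun j => (e.symm _).2) hr i
        have := (h.funcX_iff f (fun j => e.symm ⟨x j, hx j⟩) r i ⟨_, hmem⟩).2 rfl
        simp only [Equiv.apply_symm_apply] at this
        rw [this]
        exact (e _).2
      funcR_mem := fun f x r hx hr i => by
        have := h.symm.funcR_eq f (fun j => ⟨x j, hx j⟩) r i
        dsimp only at this
        rw [← this]
        exact C.funcR_mem f _ r (fun j => (e.symm _).2) hr i }
  exact (hC'.isContainedIn (B := N) subset_rfl).2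

theorem reals_eq (h : IsAtomicEquiv e) (hC : C.IsFG) (hC' : C'.IsFG) : C.reals = C'.reals :=
  (h.symm.reals_subset hC).antisymm (h.reals_subset hC')

/-- An isomorphism of finitely generated substructures from a map preserving atomic formulas. -/
def toIso (h : IsAtomicEquiv e) (hC : C.IsFG) (hC' : C'.IsFG) : Iso C C' where
  toEquiv := e
  reals_eq := h.reals_eq hC hC'
  dist_eq := h.dist_eq
  funcX_eq f x r _ i := (h.funcX_iff f x r i ⟨_, _⟩).2 rfl
  funcR_eq f x r _ i := h.funcR_eq f x r i
  rel_iff R x r _ := h.rel_iff R x r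

end IsAtomicEquiv

theorem Substructure.EquivOver.exists_atomicEquiv {A C C' : M.Substructure}
    (h : EquivOver A C' C) (hAC : A.pts ⊆ C.pts) :
    ∃ e : C.pts ≃ C'.pts, IsAtomicEquiv e ∧ ∀ x (hx : x ∈ A.pts), (e ⟨x, hAC hx⟩ : X) = x := by
  obtain ⟨e, he⟩ := h
  have key : ∀ φ : QFFormula L (C.pts ⊕ A.pts),
      M.Sat (Sum.elim (fun c : C.pts => (e c : X)) (fun a : A.pts => (a : X))) φ ↔
        M.Sat (Sum.elim (fun c : C.pts => (c : X)) (fun a : A.pts => (a : X))) φ :=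
    fun φ => Set.ext_iff.1 he φ
  refine ⟨e, ⟨fun x y => ?_, fun f x r i y => ?_, fun f x r i => ?_, fun R x r => ?_⟩,
    fun x hx => ?_⟩
  · have := (key (.eqR (.dist (.var (.inl x)) (.var (.inl y)))
      (.const (dist (x : X) (y : X))))).2 rfl
    exact congrArg ULift.down this
  · exact key (.eqX (.funcX f i (fun j => .var (.inl (x j))) (fun j => .const (r j)))
      (.var (.inl y)))
  · have := (key (.eqR (.funcR f i (fun j => .var (.inl (x j))) (fun j => .const (r j)))
      (.const ((M.func f (fun j => (x j : X)) r).2 i)))).2 rfl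
    exact congrArg ULift.down this
  · exact key (.rel R (fun j => .var (.inl (x j))) (fun j => .const (r j)))
  · exact (key (.eqX (.var (.inl ⟨x, hAC hx⟩)) (.var (.inr ⟨x, hx⟩)))).2 rfl

/-- Homogeneity realizes the equivalence of `C` and `C'` over `A` by some `k` fixing `A`. If `b` and
`c` agree on `A`, then so do `b` and `k * c * k⁻¹`, and independence merges their restrictions to
`B` and `C'` into an automorphism of the join, which homogeneity extends. -/
theorem HasExtensionProperty.exists_amalgam (hM : M.HasExtensionProperty)
    (hhom : M.IsHomogeneous) {P Q R : Set X} (hP : P ∈ M.fgSets) (hQ : Q ∈ M.fgSets)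
    (hR : R ∈ M.fgSets) (hPQ : P ⊆ Q) (hPR : P ⊆ R) :
    ∃ k : M.Aut, AgreeOn P k 1 ∧ ∃ D ∈ M.fgSets, Q ⊆ D ∧ k • R ⊆ D ∧
      ∀ b c : M.Aut, b • Q = Q → c • R = R → b • P = P → AgreeOn P b c →
        ∃ g : M.Aut, g • D = D ∧ AgreeOn Q g b ∧ AgreeOn (k • R) g (k * c * k⁻¹) := by
  obtain ⟨A, hA, rfl⟩ := hP
  obtain ⟨B, hB, rfl⟩ := hQ
  obtain ⟨C, hC, rfl⟩ := hR
  obtain ⟨C', hC', hAC', hCC', hind⟩ :=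
    hM A B C hA hB hC (hA.isContainedIn hPQ) (hA.isContainedIn hPR)
  obtain ⟨e, he, heA⟩ := hCC'.exists_atomicEquiv hPR
  obtain ⟨k, hk, hkC⟩ := hhom.exists_aut hC hC' (he.toIso hC hC')
  have hkA : AgreeOn A.pts k 1 := fun x hx => by
    rw [one_smul]
    exact (hk ⟨x, hPR hx⟩).trans (heA x hx)
  have hBD : B.pts ⊆ (B.join C').pts := Set.subset_union_left.trans (subset_generate M _ _)
  have hCD : C'.pts ⊆ (B.join C').pts := Set.subset_union_right.trans (subset_generate M _ _)
  refine ⟨k, hkA, _, ⟨_, hB.join hC', rfl⟩, hBD, hkC ▸ hCD, fun b c hb hc hbA hbc => ?_⟩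
  have hkc : (k * c * k⁻¹) • C'.pts = C'.pts := by
    rw [← hkC, mul_smul, inv_smul_smul, mul_smul, hc]
  have hkcA : ∀ x ∈ A.pts, (k * c * k⁻¹) • x = b • x := fun x hx => by
    have h1 : k⁻¹ • x = x := by
      rw [inv_smul_eq_iff, hkA x hx, one_smul]
    have h2 : b • x ∈ A.pts := hbA ▸ Set.smul_mem_smul_set hx
    rw [mul_smul, mul_smul, h1, ← hbc x hx, hkA _ h2, one_smul]
  obtain ⟨χ, hχB, hχC⟩ := hind (isoOfAut b hb rfl) (isoOfAut (k * c * k⁻¹) hkc rfl)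
    (fun x hx => hbA ▸ Set.smul_mem_smul_set hx)
    (fun x hx => by
      change (k * c * k⁻¹) • (x : X) ∈ A.pts
      rw [hkcA _ hx]
      exact hbA ▸ Set.smul_mem_smul_set hx)
    (fun x _ _ hx => (hkcA x hx).symm)
  obtain ⟨g, hg, hgD⟩ := hhom.exists_aut (hB.join hC') (hB.join hC') χ
  refine ⟨g, hgD, fun x hx => ?_, ?_⟩
  · obtain ⟨hx', e⟩ := hχB x hx
    exact (hg ⟨x, hx'⟩).trans e
  · rw [hkC]
    intro x hx
    obtain ⟨hx', e⟩ := hχC x hx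
    exact (hg ⟨x, hx'⟩).trans e

end MetricStructure

/-! ### Reduction to a countable family. -/

/-- A countable set is contained in a countable set closed under countably many operations. -/
theorem exists_countable_closed {U ι : Type*} [Countable ι] (op : ι → List U → U) {C₀ : Set U}
    (hC₀ : C₀.Countable) :
    ∃ C : Set U, C₀ ⊆ C ∧ C.Countable ∧ ∀ i l, (∀ x ∈ l, x ∈ C) → op i l ∈ C := by
  let next : Set U → Set U := fun C => C ∪ ⋃ i, op i '' {l | ∀ x ∈ l, x ∈ C}
  have hnext : ∀ C : Set U, C.Countable → (next C).Countable := by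
    intro C hC
    have := hC.to_subtype
    have hl : {l : List U | ∀ x ∈ l, x ∈ C}.Countable := by
      refine (Set.countable_range fun l : List C => l.map Subtype.val).mono fun l hl => ?_
      exact ⟨l.attachWith _ hl, by simp⟩
    exact hC.union (Set.countable_iUnion fun i => hl.image _)
  let C : ℕ → Set U := fun n => next^[n] C₀
  have hCsucc : ∀ n, C (n + 1) = next (C n) := fun n => Function.iterate_succ_apply' _ _ _
  have hmono : Monotone C := monotone_nat_of_le_succ fun n => by
    rw [hCsucc]
    exact Set.subset_union_left
  refine ⟨⋃ n, C n, Set.subset_iUnion C 0, Set.countable_iUnion fun n => ?_, fun i l hl => ?_⟩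
  · induction n with
    | zero => exact hC₀
    | succ n ih => rw [hCsucc]; exact hnext _ ih
  · have : ∃ n, ∀ x ∈ l, x ∈ C n := by
      induction l with
      | nil => exact ⟨0, by simp⟩
      | cons a l ih =>
        obtain ⟨n, hn⟩ := ih fun x hx => hl x (List.mem_cons_of_mem _ hx)
        obtain ⟨m, hm⟩ := Set.mem_iUnion.1 (hl a List.mem_cons_self)
        refine ⟨max n m, fun x hx => ?_⟩
        rcases List.mem_cons.1 hx with rfl | hx
        · exact hmono (le_max_right _ _) hm
        · exact hmono (le_max_left _ _) (hn x hx)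
    obtain ⟨n, hn⟩ := this
    refine Set.mem_iUnion.2 ⟨n + 1, ?_⟩
    rw [hCsucc]
    exact Or.inr (Set.mem_iUnion.2 ⟨i, l, hn, rfl⟩)

open scoped Pointwise in
/-- The family `F` has locally finite partial automorphisms and amalgamation, with respect to
elements of the subgroup `K`. -/
structure HasAmalgamation {G X : Type*} [Group G] [MulAction G X] (K : Subgroup G)
    (F : Set (Set X)) : Prop where
  smul_mem : ∀ g ∈ K, ∀ A ∈ F, g • A ∈ F
  directed : ∀ A ∈ F, ∀ B ∈ F, ∃ C ∈ F, A ⊆ C ∧ B ⊆ C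
  locallyFinite : ∀ A ∈ F, ∀ l : List G, (∀ g ∈ l, g ∈ K) → ∃ B ∈ F, A ⊆ B ∧
    ∀ g ∈ l, ∃ h ∈ K, AgreeOn A h g ∧ h • B = B
  amalgamation : ∀ A ∈ F, ∀ B ∈ F, ∀ C ∈ F, A ⊆ B → A ⊆ C →
    ∃ k ∈ K, AgreeOn A k 1 ∧ ∃ D ∈ F, B ⊆ D ∧ k • C ⊆ D ∧
      ∀ b ∈ K, ∀ c ∈ K, b • B = B → c • C = C → b • A = A → AgreeOn A b c →
        ∃ g ∈ K, g • D = D ∧ AgreeOn B g b ∧ AgreeOn (k • C) g (k * c * k⁻¹)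

namespace HasAmalgamation

open scoped Pointwise

variable {G X : Type*} [Group G] [MulAction G X] {K : Subgroup G} {F : Set (Set X)}

/-- A downward Löwenheim–Skolem theorem. -/
theorem exists_countable (hF : HasAmalgamation (⊤ : Subgroup G) F) {K₀ : Set G}
    (hK₀ : K₀.Countable) {F₀ : Set (Set X)} (hF₀ : F₀.Countable) (hF₀F : F₀ ⊆ F) :
    ∃ (K : Subgroup G) (F' : Set (Set X)), K₀ ⊆ K ∧ (K : Set G).Countable ∧ F₀ ⊆ F' ∧ F' ⊆ F ∧
      F'.Countable ∧ HasAmalgamation K F' := by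
  have hlf : ∀ A ∈ F, ∀ l : List G, ∃ B ∈ F, A ⊆ B ∧
      ∀ g ∈ l, ∃ h : G, AgreeOn A h g ∧ h • B = B := fun A hA l => by
    obtain ⟨B, hB, h1, h2⟩ := hF.locallyFinite A hA l fun _ _ => trivial
    exact ⟨B, hB, h1, fun g hg => (h2 g hg).imp fun _ h => h.2⟩
  have ham : ∀ A ∈ F, ∀ B ∈ F, ∀ C ∈ F, A ⊆ B → A ⊆ C →
      ∃ k : G, AgreeOn A k 1 ∧ ∃ D ∈ F, B ⊆ D ∧ k • C ⊆ D ∧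
        ∀ b c : G, b • B = B → c • C = C → b • A = A → AgreeOn A b c →
          ∃ g : G, g • D = D ∧ AgreeOn B g b ∧ AgreeOn (k • C) g (k * c * k⁻¹) :=
      fun A hA B hB C hC h1 h2 => by
    obtain ⟨k, -, hk, D, hD, d1, d2, d3⟩ := hF.amalgamation A hA B hB C hC h1 h2
    refine ⟨k, hk, D, hD, d1, d2, fun b c h1 h2 h3 h4 => ?_⟩
    obtain ⟨g, -, hg⟩ := d3 b trivial c trivial h1 h2 h3 h4
    exact ⟨g, hg⟩
  have hdir := hF.directed
  choose! dir dirF dirl dirr using hdir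
  choose! lfS lfF lfsub lfG lfagree lfinv using hlf
  choose! amK amfix amD amF amB amC amG amGD amGB amGC using ham
  -- Group elements and sets are closed off together. Codes 0 to 3 are product, inverse, translate
  -- and upper bound, 4 and 5 the choices for local finiteness, and 6 to 8 those for amalgamation;
  -- any other input gives the identity.
  let op : ℕ → List (G ⊕ Set X) → G ⊕ Set X := fun i l =>
    match i, l with
    | 0, [.inl a, .inl b] => .inl (a * b)
    | 1, [.inl a] => .inl a⁻¹
    | 2, [.inl a, .inr P] => .inr (a • P)
    | 3, [.inr P, .inr Q] => .inr (dir P Q)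
    | 4, .inr P :: l => .inr (lfS P (l.filterMap Sum.getLeft?))
    | 5, .inl g :: .inr P :: l => .inl (lfG P (l.filterMap Sum.getLeft?) g)
    | 6, [.inr P, .inr Q, .inr R] => .inl (amK P Q R)
    | 7, [.inr P, .inr Q, .inr R] => .inr (amD P Q R)
    | 8, [.inr P, .inr Q, .inr R, .inl b, .inl c] => .inl (amG P Q R b c)
    | _, _ => .inl 1
  obtain ⟨C, hC₀, hCc, hC⟩ := exists_countable_closed op
    (C₀ := Sum.inl '' K₀ ∪ Sum.inr '' F₀) ((hK₀.image _).union (hF₀.image _))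
  let K : Subgroup G :=
    { carrier := {g | Sum.inl g ∈ C}
      one_mem' := hC 9 [] (by simp)
      mul_mem' := fun {a b} ha hb => hC 0 [.inl a, .inl b] (by simpa using ⟨ha, hb⟩)
      inv_mem' := fun {a} ha => hC 1 [.inl a] (by simpa using ha) }
  have hmapl : ∀ l : List G, (l.map (Sum.inl : G → G ⊕ Set X)).filterMap Sum.getLeft? = l := by
    intro l
    induction l with
    | nil => rfl
    | cons a l ih => simpa using ih
  refine ⟨K, {P | Sum.inr P ∈ C ∧ P ∈ F}, fun g hg => hC₀ (Or.inl ⟨g, hg, rfl⟩), ?_,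
    fun P hP => ⟨hC₀ (Or.inr ⟨P, hP, rfl⟩), hF₀F hP⟩, fun P hP => hP.2, ?_, ⟨?_, ?_, ?_, ?_⟩⟩
  · exact hCc.preimage Sum.inl_injective
  · exact (hCc.preimage Sum.inr_injective).mono fun P hP => hP.1
  · intro g hg P hP
    exact ⟨hC 2 [.inl g, .inr P] (by simpa using ⟨hg, hP.1⟩), hF.smul_mem g trivial P hP.2⟩
  · intro P hP Q hQ
    exact ⟨dir P Q, ⟨hC 3 [.inr P, .inr Q] (by simpa using ⟨hP.1, hQ.1⟩), dirF P hP.2 Q hQ.2⟩,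
      dirl P hP.2 Q hQ.2, dirr P hP.2 Q hQ.2⟩
  · intro P hP l hl
    have h4 : Sum.inr (lfS P l) ∈ C := by
      have := hC 4 (.inr P :: l.map .inl) (by simpa using ⟨hP.1, hl⟩)
      change Sum.inr (lfS P _) ∈ C at this
      rwa [hmapl] at this
    refine ⟨lfS P l, ⟨h4, lfF P hP.2 l⟩, lfsub P hP.2 l, fun g hg => ⟨lfG P l g, ?_,
      lfagree P hP.2 l g hg, lfinv P hP.2 l g hg⟩⟩
    have := hC 5 (.inl g :: .inr P :: l.map .inl) (by simpa using ⟨hl g hg, hP.1, hl⟩)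
    change Sum.inl (lfG P _ g) ∈ C at this
    rwa [hmapl] at this
  · intro P hP Q hQ R hR hPQ hPR
    refine ⟨amK P Q R, hC 6 [.inr P, .inr Q, .inr R] (by simpa using ⟨hP.1, hQ.1, hR.1⟩),
      amfix P hP.2 Q hQ.2 R hR.2 hPQ hPR, amD P Q R,
      ⟨hC 7 [.inr P, .inr Q, .inr R] (by simpa using ⟨hP.1, hQ.1, hR.1⟩),
        amF P hP.2 Q hQ.2 R hR.2 hPQ hPR⟩,
      amB P hP.2 Q hQ.2 R hR.2 hPQ hPR, amC P hP.2 Q hQ.2 R hR.2 hPQ hPR,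
      fun b hb c hc h1 h2 h3 h4 => ⟨amG P Q R b c,
        hC 8 [.inr P, .inr Q, .inr R, .inl b, .inl c]
          (by simpa using ⟨hP.1, hQ.1, hR.1, hb, hc⟩),
        amGD P hP.2 Q hQ.2 R hR.2 hPQ hPR b c h1 h2 h3 h4,
        amGB P hP.2 Q hQ.2 R hR.2 hPQ hPR b c h1 h2 h3 h4,
        amGC P hP.2 Q hQ.2 R hR.2 hPQ hPR b c h1 h2 h3 h4⟩⟩

/-- The group of all elements that agree with elements of `K` on each member of `F`, and whose
inverses do so as well. -/
def localClosure (hF : HasAmalgamation K F) : Subgroup G where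
  carrier := {g | (∀ A ∈ F, ∃ k ∈ K, AgreeOn A k g) ∧ ∀ A ∈ F, ∃ k ∈ K, AgreeOn A k g⁻¹}
  one_mem' := ⟨fun _ _ => ⟨1, K.one_mem, AgreeOn.refl _ _⟩,
    fun _ _ => ⟨1, K.one_mem, by rw [inv_one]; exact AgreeOn.refl _ _⟩⟩
  mul_mem' := by
    have key : ∀ g h : G, (∀ A ∈ F, ∃ k ∈ K, AgreeOn A k g) → (∀ A ∈ F, ∃ k ∈ K, AgreeOn A k h) →
        ∀ A ∈ F, ∃ k ∈ K, AgreeOn A k (g * h) := by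
      intro g h hg hh A hA
      obtain ⟨k, hk, hkh⟩ := hh A hA
      obtain ⟨l, hl, hlg⟩ := hg _ (hF.smul_mem k hk A hA)
      exact ⟨l * k, K.mul_mem hl hk, AgreeOn.mul (hkh.smul_eq ▸ hlg) hkh⟩
    rintro g h ⟨hg, hg'⟩ ⟨hh, hh'⟩
    exact ⟨key g h hg hh, by rw [mul_inv_rev]; exact key _ _ hh' hg'⟩
  inv_mem' := by
    rintro g ⟨hg, hg'⟩
    exact ⟨hg', by rwa [inv_inv]⟩

theorem le_localClosure (hF : HasAmalgamation K F) : K ≤ hF.localClosure := fun k hk =>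
  ⟨fun _ _ => ⟨k, hk, AgreeOn.refl _ _⟩, fun _ _ => ⟨k⁻¹, K.inv_mem hk, AgreeOn.refl _ _⟩⟩

/-- The local finiteness and amalgamation conditions involve the given group elements only through
their restrictions to members of `F`, so approximating by `K` transfers them from `K` to its
closure. Density of `K` gives separability, and limits along `F` remain in the closure. -/
theorem amalgamationSystem (hF : HasAmalgamation K F) (hK : (K : Set G).Countable)
    (hFc : F.Countable) (hbot : ∃ A ∈ F, (∀ B ∈ F, A ⊆ B) ∧ ∀ g : G, AgreeOn A g 1)
    (hfaith : ∀ g h : G, (∀ A ∈ F, AgreeOn A g h) → g = h)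
    (hcomp : ∀ (A : ℕ → Set X) (g : ℕ → G), Monotone A →
      (∀ n, AgreeOn (A n) (g (n + 1)) (g n)) → (∀ C ∈ F, ∃ n, C ⊆ A n ∧ C ⊆ g n • A n) →
      ∃ h : G, ∀ n, AgreeOn (A n) h (g n)) :
    AmalgamationSystem hF.localClosure F where
  countable := hFc
  smul_mem := by
    rintro ⟨g, hg, -⟩ A hA
    obtain ⟨k, hk, hkg⟩ := hg A hA
    change g • A ∈ F
    exact hkg.smul_eq ▸ hF.smul_mem k hk A hA
  directed := hF.directed
  exists_bot := by
    obtain ⟨A, hA, h1, h2⟩ := hbot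
    exact ⟨A, hA, h1, fun g => h2 g⟩
  separable := by
    refine ⟨{g | (g : G) ∈ K}, hK.preimage Subtype.val_injective, ?_⟩
    rintro ⟨g, hg, hg'⟩ A hA
    obtain ⟨k, hk, hkg⟩ := hg A hA
    exact ⟨⟨k, hF.le_localClosure hk⟩, hk, hkg⟩
  faithful g h H := Subtype.ext (hfaith g h H)
  complete := by
    intro A g hA hmono hag hcof
    obtain ⟨h, hh⟩ := hcomp A (fun n => g n) hmono hag hcof
    refine ⟨⟨h, fun C hC => ?_, fun C hC => ?_⟩, hh⟩
    · obtain ⟨n, hn, -⟩ := hcof C hC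
      obtain ⟨k, hk, hkg⟩ := (g n).2.1 C hC
      exact ⟨k, hk, hkg.trans ((hh n).mono hn).symm⟩
    -- Since `C` lies in the image of `A n` under `g n`, the inverse of the limit agrees on `C` with
    -- that of `g n`.
    · obtain ⟨n, -, hn⟩ := hcof C hC
      obtain ⟨k, hk, hkg⟩ := (g n).2.2 C hC
      refine ⟨k, hk, hkg.trans ?_⟩
      have := (hh n).inv
      rw [(hh n).smul_eq] at this
      exact (this.mono hn).symm
  locallyFinite := by
    intro A hA n g
    choose k hk hkg using fun i => (g i).2.1 A hA
    obtain ⟨B, hB, hAB, H⟩ := hF.locallyFinite A hA ((List.range n).map k) (by simp [hk])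
    have H' : ∀ i, ∃ h : hF.localClosure, i < n → AgreeOn A h (g i) ∧ h • B = B := by
      intro i
      by_cases hi : i < n
      · obtain ⟨h, hh, h1, h2⟩ := H (k i) (List.mem_map_of_mem (List.mem_range.2 hi))
        exact ⟨⟨h, hF.le_localClosure hh⟩, fun _ => ⟨h1.trans (hkg i), h2⟩⟩
      · exact ⟨1, fun h => absurd h hi⟩
    choose h hh using H'
    exact ⟨B, hB, hAB, h, hh⟩
  amalgamation := by
    intro A hA B hB C hC hAB hAC
    obtain ⟨k, hk, hkA, D, hD, h1, h2, h3⟩ := hF.amalgamation A hA B hB C hC hAB hAC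
    refine ⟨⟨k, hF.le_localClosure hk⟩, hkA, D, hD, h1, h2, ?_⟩
    rintro ⟨b, hb, hb'⟩ ⟨c, hc, hc'⟩ e1 e2 e3 e4
    obtain ⟨p, hp, hpb⟩ := hb B hB
    obtain ⟨q, hq, hqc⟩ := hc C hC
    obtain ⟨g, hg, g1, g2, g3⟩ := h3 p hp q hq (hpb.smul_eq.trans e1) (hqc.smul_eq.trans e2)
      ((hpb.mono hAB).smul_eq.trans e3)
      (((hpb.mono hAB).trans e4).trans (hqc.mono hAC).symm)
    refine ⟨⟨g, hF.le_localClosure hg⟩, g1, g2.trans hpb, g3.trans ?_⟩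
    have h4 : AgreeOn (k • C) (k * q * k⁻¹) (k * c * k⁻¹) := by
      rw [agreeOn_smul_iff]
      simpa using hqc.mul_left k
    exact h4

end HasAmalgamation

/-! ### Limits of automorphisms and the conclusion. -/

namespace MetricStructure

open Filter Topology
open scoped Pointwise

variable {L : MetricSignature} {X : Type u} [MetricSpace X] {M : MetricStructure L X}

/-- Isometries that are eventually constant at each point of a dense set form a Cauchy sequence at
every point. -/
theorem exists_tendsto_smul [CompleteSpace X] {D : Set X} (hD : Dense D) (u : ℕ → M.Aut)
    (hu : ∀ x ∈ D, ∃ n, ∀ m ≥ n, u m • x = u n • x) (x : X) :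
    ∃ y, Tendsto (fun n => u n • x) atTop (𝓝 y) := by
  refine cauchySeq_tendsto_of_complete (Metric.cauchySeq_iff'.2 fun ε hε => ?_)
  obtain ⟨d, hd, hxd⟩ := hD.exists_dist_lt x (show 0 < ε / 2 by positivity)
  obtain ⟨N, hN⟩ := hu d hd
  refine ⟨N, fun n hn => ?_⟩
  have h1 := dist_triangle (u n • x) (u n • d) (u N • x)
  rw [dist_aut_smul, hN n hn, dist_aut_smul, dist_comm d x] at h1
  linarith

theorem mem_rel_of_tendsto {u : ℕ → M.Aut} {φ : X → X}
    (hφ : ∀ x, Tendsto (fun n => u n • x) atTop (𝓝 (φ x))) {R : L.Rel} {x : Fin (L.relX R) → X}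
    {r : Fin (L.relR R) → ℝ} (hx : (x, r) ∈ M.rel R) : ((fun i => φ (x i)), r) ∈ M.rel R :=
  (M.isClosed_rel R r).mem_of_tendsto (tendsto_pi_nhds.2 fun i => hφ (x i))
    (Eventually.of_forall fun n => (rel_smul_iff (u n) R x r).2 hx)

/-- A sequence of automorphisms converging pointwise together with its inverses converges to an
automorphism. -/
theorem exists_aut_of_tendsto {u : ℕ → M.Aut} {φ ψ : X → X}
    (hφ : ∀ x, Tendsto (fun n => u n • x) atTop (𝓝 (φ x)))
    (hψ : ∀ x, Tendsto (fun n => (u n)⁻¹ • x) atTop (𝓝 (ψ x))) :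
    ∃ g : M.Aut, ∀ x, g • x = φ x := by
  have hiso : Isometry φ := Isometry.of_dist_eq fun x y =>
    tendsto_nhds_unique ((hφ x).dist (hφ y)) (by simp only [dist_aut_smul]; exact tendsto_const_nhds)
  have hφψ : ∀ x, φ (ψ x) = x := fun x => by
    refine tendsto_nhds_unique (hφ (ψ x)) (tendsto_iff_dist_tendsto_zero.2 ?_)
    refine (tendsto_iff_dist_tendsto_zero.1 (hψ x)).congr fun n => ?_
    rw [← dist_aut_smul (u n), smul_inv_smul, dist_comm]
  have hψφ : ∀ x, ψ (φ x) = x := fun x => hiso.injective (hφψ (φ x))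
  refine ⟨⟨IsometryEquiv.mk' φ ψ hφψ hiso, fun f x r => ?_, fun R x r => ⟨fun h => ?_, fun h => ?_⟩⟩,
    fun _ => rfl⟩
  · have h1 : Tendsto (fun n => M.func f (fun i => u n • x i) r) atTop
        (𝓝 (M.func f (fun i => φ (x i)) r)) :=
      ((M.continuous_func f r).tendsto _).comp (tendsto_pi_nhds.2 fun i => hφ (x i))
    simp only [func_smul] at h1
    exact tendsto_nhds_unique h1
      ((tendsto_pi_nhds.2 fun i => hφ ((M.func f x r).1 i)).prodMk_nhds tendsto_const_nhds)
  · have h1 : ((fun i => φ (x i)), r) ∈ M.rel R := h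
    simpa [hψφ] using mem_rel_of_tendsto hψ h1
  · exact mem_rel_of_tendsto hφ h

/-- The sets `A n` make the `g n` converge, and their images `g n • A n` make the inverses converge;
both are needed for the limit to be a bijection that reflects the relations. -/
theorem exists_aut_limit [CompleteSpace X] {D : Set X} (hD : Dense D) {A : ℕ → Set X}
    {g : ℕ → M.Aut} (hA : Monotone A) (hg : ∀ n, AgreeOn (A n) (g (n + 1)) (g n))
    (hcof : ∀ x ∈ D, ∃ n, x ∈ A n ∧ x ∈ g n • A n) :
    ∃ h : M.Aut, ∀ n, AgreeOn (A n) h (g n) := by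
  have hconst : ∀ n m, n ≤ m → AgreeOn (A n) (g m) (g n) := by
    intro n m hnm
    induction m, hnm using Nat.le_induction with
    | base => exact AgreeOn.refl _ _
    | succ m hm ih => exact ((hg m).mono (hA hm)).trans ih
  choose φ hφ using exists_tendsto_smul hD g fun x hx => by
    obtain ⟨n, hn, -⟩ := hcof x hx
    exact ⟨n, fun m hm => hconst n m hm x hn⟩
  choose ψ hψ using exists_tendsto_smul hD (fun n => (g n)⁻¹) fun x hx => by
    obtain ⟨n, -, a, ha, rfl⟩ := hcof x hx
    refine ⟨n, fun m hm => ?_⟩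
    change (g m)⁻¹ • g n • a = (g n)⁻¹ • g n • a
    rw [← hconst n m hm a ha, inv_smul_smul, hconst n m hm a ha, inv_smul_smul]
  obtain ⟨h, hh⟩ := exists_aut_of_tendsto hφ hψ
  refine ⟨h, fun n x hx => ?_⟩
  rw [hh]
  refine tendsto_nhds_unique (hφ x) (tendsto_const_nhds.congr' ?_)
  filter_upwards [eventually_ge_atTop n] with m hm
  exact (hconst n m hm x hx).symm

theorem hasAmalgamation_fgSets (hhom : M.IsHomogeneous) (hlfa : M.HasLocallyFiniteAutomorphisms)
    (hext : M.HasExtensionProperty) : HasAmalgamation (⊤ : Subgroup M.Aut) M.fgSets where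
  smul_mem g _ _ hP := smul_mem_fgSets g hP
  directed _ hP _ hQ := fgSets_directed hP hQ
  locallyFinite P hP l _ := by
    obtain ⟨Q, hQ, h1, h2⟩ := hlfa.exists_extension hhom hP l
    exact ⟨Q, hQ, h1, fun g hg => (h2 g hg).imp fun _ h => ⟨trivial, h⟩⟩
  amalgamation P hP Q hQ R hR h1 h2 := by
    obtain ⟨k, hk, D, hD, d1, d2, d3⟩ := hext.exists_amalgam hhom hP hQ hR h1 h2
    refine ⟨k, trivial, hk, D, hD, d1, d2, fun b _ c _ e1 e2 e3 e4 => ?_⟩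
    obtain ⟨g, hg⟩ := d3 b c e1 e2 e3 e4
    exact ⟨g, trivial, hg⟩

/-- Every automorphism lies in a subgroup of the automorphism group that is part of an
amalgamation system. -/
theorem exists_amalgamationSystem [TopologicalSpace.SeparableSpace X] [CompleteSpace X]
    (hhom : M.IsHomogeneous) (hlfa : M.HasLocallyFiniteAutomorphisms)
    (hext : M.HasExtensionProperty) (g : M.Aut) :
    ∃ (Γ : Subgroup M.Aut) (F : Set (Set X)), g ∈ Γ ∧ AmalgamationSystem Γ F := by
  obtain ⟨s, hs, hsd⟩ := TopologicalSpace.exists_countable_dense X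
  choose P hP hxP using M.exists_mem_fgSets_of_mem
  obtain ⟨P₀, hP₀, hbot, hfix⟩ := M.exists_mem_fgSets_bot
  -- Besides the least substructure, `F` is made to cover a countable dense set of points, so that
  -- agreement along `F` determines an automorphism and limits along `F` exist.
  obtain ⟨K, F, hgK, hK, hF₀, hF, hFc, hKF⟩ :=
    (hasAmalgamation_fgSets hhom hlfa hext).exists_countable (Set.countable_singleton g)
      (F₀ := insert P₀ (P '' s)) ((hs.image P).insert P₀)
      (Set.insert_subset hP₀ (Set.image_subset_iff.2 fun x _ => hP x))
  have hPF : ∀ x ∈ s, P x ∈ F := fun x hx => hF₀ (Set.mem_insert_of_mem _ ⟨x, hx, rfl⟩)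
  refine ⟨hKF.localClosure, F, hKF.le_localClosure (hgK rfl),
    hKF.amalgamationSystem hK hFc ?_ ?_ ?_⟩
  · exact ⟨P₀, hF₀ (Set.mem_insert _ _), fun B hB => hbot B (hF hB), hfix⟩
  · intro g h H
    refine Subtype.ext (IsometryEquiv.ext fun x => ?_)
    exact congrFun (Continuous.ext_on hsd (g : X ≃ᵢ X).continuous (h : X ≃ᵢ X).continuous
      fun y hy => H (P y) (hPF y hy) y (hxP y)) x
  · intro A u hA hu hcof
    refine exists_aut_limit hsd hA hu fun x hx => ?_
    obtain ⟨n, h1, h2⟩ := hcof (P x) (hPF x hx)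
    exact ⟨n, h1 (hxP x), h2 (hxP x)⟩

end MetricStructure

theorem mainTheorem7 {L : MetricSignature} {X : Type u} [MetricSpace X]
    [TopologicalSpace.SeparableSpace X] [CompleteSpace X] (M : MetricStructure L X)
    (hhom : M.IsHomogeneous) (hind : M.AdmitsIndependentSequences)
    (hlfa : M.HasLocallyFiniteAutomorphisms) (hext : M.HasExtensionProperty)
    (H : Type v) [Group H] [TopologicalSpace H] [IsTopologicalGroup H] [PolishSpace H]
    (hH : AdmitsCompleteLeftInvariantMetric H) :
    IsTrivialFor M.Aut H := by
  intro φ g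
  -- The group `Γ` depends on `g`; only the restriction of `φ` to it matters.
  obtain ⟨Γ, F, hg, hΓ⟩ := MetricStructure.exists_amalgamationSystem hhom hlfa hext g
  obtain ⟨m, rfl, hc, hd⟩ := hH
  exact hΓ.map_eq_one hd (φ.comp Γ.subtype) ⟨g, hg⟩
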